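/- Let $A\in\mathbb R^{m\times n}$ have rows $a_1,\dots,a_m$, let $[m]=\mathcal P_1\uplus\dots\uplus\mathcal P_p$ be a partition with $m_l=|\mathcal P_l|$, let $k_1,\dots,k_p\in\mathbb N$ and $k=\sum_l k_l\ge 1$. For $S\subseteq[m]$ let $A_S$ be the submatrix of the rows indexed by $S$, and let $\pi_S(A)$ be the matrix whose rows are the orthogonal projections of $a_1,\dots,a_m$ onto the span of the rows indexed by $S$. The DPP of $A$ is the law on subsets $S\subseteq[m]$ with $\Pr(S)\propto\det(A_SA_S^T)$. Assume that the event $\{|S\cap\mathcal P_l|=k_l \text{ for all } l\}$ has positive probability (so that $k\le\operatorname{rank}A$); the Partition-DPP is the DPP conditioned on this event. Its ordered version is the law of the random tuple $(X_1,\dots,X_k)\in[m]^k$ with $$\Pr(X_1=i_1,\dots,X_k=i_k)=\frac{\det(A_{\{i_1,\dots,i_k\}}A_{\{i_1,\dots,i_k\}}^T)}{k!\,\sum_{S:\,|S\cap\mathcal P_l|=k_l\,\forall l}\det(A_SA_S^T)}$$ if $i_1,\dots,i_k$ are distinct and $\{i_1,\dots,i_k\}$ satisfies the constraint, and $0$ otherwise.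 For $M\in\mathbb R^{m\times m}$ let $c_{e_1,\dots,e_p}(M)$ be the coefficient of $x_1^{e_1}\cdots x_p^{e_p}$ in $\det(M-x_1I_1-\dots-x_pI_p)$, where $I_l$ is the diagonal $0/1$ matrix that indicates $\mathcal P_l$. Algorithm. Start with $S=\emptyset$, $B=A$. Repeat $k$ times: with $t_l=|S\cap\mathcal P_l|$ compute, for every $i\in[m]$ (say $i\in\mathcal P_j$), the weight $$w_i=\|b_i\|^2\,\bigl|c_{m_1-k_1+t_1,\dots,m_j-k_j+t_j+1,\dots,m_p-k_p+t_p}(C_iC_i^T)\bigr|,$$ where $b_i$ is the $i$-th row of $B$ and $C_i$ is $B$ with all rows projected orthogonally to $b_i$ ($w_i=0$ if $b_i=0$); draw $i$ with probability proportional to $w_i$, add $i$ to $S$ and replace $B$ by $C_i$. Return $S$. The coefficient is obtained by multivariate interpolation: $\det(C_iC_i^T-\sum_l x_lI_l)$ is evaluated by Gaussian elimination at the $\prod_l(m_l+1)$ points $x\in\prod_l\{-1,\dots,-(m_l+1)\}$, and the corresponding row of the inverse of the tensor-product Vandermonde matrix is applied to the values. Cost model: a randomized real RAM with exact real arithmetic,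 in which an arithmetic operation, a sign test, the loading of an integer and a bookkeeping step (a pass through a loop, the storing of a table entry) cost $1$, and drawing one of $N$ items with probability proportional to given weights costs $N+1$. Then: 1. (Exactness.) The algorithm never divides by zero and never draws with invalid weights, and its output has exactly the law of the Partition-DPP; the sequence of picked items has exactly the law of $(X_1,\dots,X_k)$. The weights computed after the items of $S$ have been picked are $w_i=\|b_i\|^2\,|c_{m_1-k_1+t_1,\dots,m_j-k_j+t_j+1,\dots,m_p-k_p+t_p}(C_iC_i^T)|$ with $B=A-\pi_S(A)$ and $C_i=A-\pi_{S\cup\{i\}}(A)$, and whenever $t<k$, $S=\{i_1,\dots,i_t\}$ and $\Pr(X_1=i_1,\dots,X_t=i_t)>0$, $$\Pr(X_{t+1}=i\mid X_1=i_1,\dots,X_t=i_t)=\frac{w_i}{(k-t)\,\bigl|c_{m_1-k_1+t_1,\dots,m_p-k_p+t_p}(BB^T)\bigr|}.$$ 2. (Running time.) There is an absolute constant $C$ such that, if $p\le m$ (in particular if all parts are nonempty), the algorithm takes at most $C\,m^4\,(1+m/p)^p\,n\,k$ steps in the worst case. For every fixed number $p$ of parts there is a constant $C_p$, depending only on $p$,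 such that the algorithm takes at most $C_p\,m^{p+4}nk/p^p$ steps in the worst case; this is polynomial in $m$, $n$ and $k$. -/

import Mathlib

namespace PartitionDPP

/-! ## The distributions -/

section Distributions

variable {m n p : ℕ}

/-- `det (A_S A_Sᵀ)`, where `A_S` consists of the rows of `A` indexed by `S`. -/
noncomputable def gramDet (A : Matrix (Fin m) (Fin n) ℝ) (S : Finset (Fin m)) : ℝ :=
  (A.submatrix (Subtype.val : S → Fin m) id * (A.submatrix (Subtype.val : S → Fin m) id).transpose).det

theorem gramDet_empty (A : Matrix (Fin m) (Fin n) ℝ) : gramDet A ∅ = 1 := by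
  simp [gramDet]

/-- The determinantal point process with kernel `A Aᵀ`: the law on subsets `S` of the ground set
whose probabilities are proportional to `det (A_S A_Sᵀ)`. -/
noncomputable def dpp (A : Matrix (Fin m) (Fin n) ℝ) : PMF (Finset (Fin m)) :=
  PMF.normalize (fun S => ENNReal.ofReal (gramDet A S))
    (by
      intro h
      have h1 := ENNReal.tsum_eq_zero.mp h ∅
      simp [gramDet_empty] at h1)
    (by
      rw [tsum_fintype]
      exact ENNReal.sum_ne_top.mpr fun _ _ => ENNReal.ofReal_ne_top)

/-- The size of the `l`-th part of the partition `P_l = {i | part i = l}`. -/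
def partSize (part : Fin m → Fin p) (l : Fin p) : ℕ :=
  (Finset.univ.filter fun i => part i = l).card

/-- The number of elements of `S` in the `l`-th part. -/
def partCount (part : Fin m → Fin p) (S : Finset (Fin m)) (l : Fin p) : ℕ :=
  (S.filter fun i => part i = l).card

/-- The subsets `S` that satisfy the partition constraint `|S ∩ P_l| = k_l` for all `l`. -/
def constraintSet (part : Fin m → Fin p) (k : Fin p → ℕ) : Set (Finset (Fin m)) :=
  {S | ∀ l, partCount part S l = k l}

/-- The constraint has positive probability under the DPP. -/
def Feasible (A : Matrix (Fin m) (Fin n) ℝ) (part : Fin m → Fin p) (k : Fin p → ℕ) : Prop :=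
  ∃ S ∈ constraintSet part k, S ∈ (dpp A).support

/-- The Partition-DPP: the DPP conditioned on the partition constraint. -/
noncomputable def partitionDPP (A : Matrix (Fin m) (Fin n) ℝ) (part : Fin m → Fin p)
    (k : Fin p → ℕ) (h : Feasible A part k) : PMF (Finset (Fin m)) :=
  (dpp A).filter (constraintSet part k) h

open Classical in
/-- The Partition-DPP as a distribution on ordered tuples `(i_1, …, i_k)`, `k = ∑ k_l`. -/
noncomputable def orderedProb (A : Matrix (Fin m) (Fin n) ℝ) (part : Fin m → Fin p)
    (k : Fin p → ℕ) (x : Fin (∑ l, k l) → Fin m) : ℝ :=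
  if Function.Injective x ∧ Finset.univ.image x ∈ constraintSet part k then
    gramDet A (Finset.univ.image x) /
      ((∑ l, k l).factorial *
        ∑ S ∈ Finset.univ.filter (fun S => S ∈ constraintSet part k), gramDet A S)
  else 0

open Classical in
/-- The probability `Pr (X_1 = i_1, …, X_t = i_t)` that the ordered tuple starts with
`y = (i_1, …, i_t)`, where `t ≤ k`. -/
noncomputable def prefixProb (A : Matrix (Fin m) (Fin n) ℝ) (part : Fin m → Fin p)
    (k : Fin p → ℕ) {t : ℕ} (y : Fin t → Fin m) : ℝ :=
  ∑ x ∈ Finset.univ.filter (fun x : Fin (∑ l, k l) → Fin m =>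
      ∀ (a : Fin (∑ l, k l)) (b : Fin t), a.val = b.val → x a = y b),
    orderedProb A part k x

/-- The multivariate characteristic polynomial `det (M - x_1 I_1 - ⋯ - x_p I_p)`. -/
noncomputable def mvCharpoly (M : Matrix (Fin m) (Fin m) ℝ) (part : Fin m → Fin p) :
    MvPolynomial (Fin p) ℝ :=
  (M.map MvPolynomial.C - Matrix.diagonal fun i => MvPolynomial.X (part i)).det

/-- The coefficient `c_{e_1, …, e_p}` of the multivariate characteristic polynomial. -/
noncomputable def charCoeff (M : Matrix (Fin m) (Fin m) ℝ) (part : Fin m → Fin p)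
    (e : Fin p → ℕ) : ℝ :=
  (mvCharpoly M part).coeff (Finsupp.equivFunOnFinite.symm e)

/-- `A - π_S(A)`: the orthogonal projection onto the span of the rows indexed by `S` is
subtracted from every row of `A`. -/
noncomputable def residual (A : Matrix (Fin m) (Fin n) ℝ) (S : Finset (Fin m)) :
    Matrix (Fin m) (Fin n) ℝ :=
  Matrix.of fun r => WithLp.ofLp
    ((WithLp.toLp 2 (A r) : EuclideanSpace ℝ (Fin n)) -
      (Submodule.span ℝ ((fun i => (WithLp.toLp 2 (A i) : EuclideanSpace ℝ (Fin n))) '' S)).starProjection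
        (WithLp.toLp 2 (A r)))

/-- The index `m_1 - k_1 + t_1, …, m_j - k_j + t_j + 1, …, m_p - k_p + t_p` of the coefficient
that is used for an item `i` in the part `j`, when `t_l` items have been taken from `P_l`. -/
def coeffIndex (part : Fin m → Fin p) (sizes k t : Fin p → ℕ) (i : Fin m) (l : Fin p) : ℕ :=
  sizes l - k l + t l + if l = part i then 1 else 0

/-- The weight `‖b_i‖² |c'(C_i C_iᵀ)|` of the item `i` after the items of `S` have been picked, for
`B = A - π_S(A)` and `C_i = A - π_{S ∪ {i}}(A)`. -/
noncomputable def itemWeight (A : Matrix (Fin m) (Fin n) ℝ) (part : Fin m → Fin p)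
    (k : Fin p → ℕ) (S : Finset (Fin m)) (i : Fin m) : ℝ :=
  ‖(WithLp.toLp 2 (residual A S i) : EuclideanSpace ℝ (Fin n))‖ ^ 2 *
    |charCoeff (residual A (insert i S) * (residual A (insert i S)).transpose) part
      (coeffIndex part (partSize part) k (partCount part S) i)|

end Distributions

/-! ## The machine model: randomized real computations with unit costs

A program is a tree of elementary instructions. Programs below are written for an arbitrary type
`R` of scalars, so that they can get hold of a scalar only by executing an instruction. -/

/-- The arithmetic operations on scalars. -/
inductive ArithOp
  | add | sub | mul | div

/-- Randomized computations with scalars in `R` and a result in `α`: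
* `ret a` stops and returns `a`;
* `tick c` is one step of bookkeeping (a pass through a loop, the storing of a table entry,
  an operation on indices), followed by `c`;
* `int z c` loads the integer `z` as a scalar;
* `arith op x y c` performs one arithmetic operation;
* `pos x c` tests whether `x` is positive;
* `draw N w c` draws an index `i` with probability proportional to `w i`. -/
inductive Comp (R α : Type) : Type
  | ret (a : α) : Comp R α
  | tick (c : Comp R α) : Comp R α
  | int (z : ℤ) (c : R → Comp R α) : Comp R α
  | arith (op : ArithOp) (x y : R) (c : R → Comp R α) : Comp R α
  | pos (x : R) (c : Bool → Comp R α) : Comp R α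
  | draw (N : ℕ) (w : Fin N → R) (c : Fin N → Comp R α) : Comp R α

namespace Comp

variable {R α β : Type}

/-- Sequential composition. -/
def andThen : Comp R α → (α → Comp R β) → Comp R β
  | ret a, g => g a
  | tick c, g => tick (andThen c g)
  | int z c, g => int z fun x => andThen (c x) g
  | arith op x y c, g => arith op x y fun z => andThen (c z) g
  | pos x c, g => pos x fun b => andThen (c b) g
  | draw N w c, g => draw N w fun i => andThen (c i) g

instance : Monad (Comp R) where
  pure := ret
  bind := andThen

/-- The value of an arithmetic operation on real numbers. -/
noncomputable def ArithOp.eval : ArithOp → ℝ → ℝ → ℝ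
  | .add, x, y => x + y
  | .sub, x, y => x - y
  | .mul, x, y => x * y
  | .div, x, y => x / y

open Classical in
/-- The law of the result over the reals. The result `none` means that the computation crashed:
it divided by zero, or drew with respect to weights that are not nonnegative with a positive
sum. -/
noncomputable def run : Comp ℝ α → PMF (Option α)
  | ret a => PMF.pure (some a)
  | tick c => run c
  | int z c => run (c z)
  | arith op x y c =>
      if op = ArithOp.div ∧ y = 0 then PMF.pure none else run (c (ArithOp.eval op x y))
  | pos x c => run (c (decide (0 < x)))
  | draw _ w c =>
      if h : (∀ i, 0 ≤ w i) ∧ 0 < ∑ i, w i then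
        (PMF.normalize (fun i => ENNReal.ofReal (w i))
          (by
            rw [tsum_fintype, ← ENNReal.ofReal_sum_of_nonneg fun i _ => h.1 i]
            exact (ENNReal.ofReal_pos.mpr h.2).ne')
          (by
            rw [tsum_fintype]
            exact ENNReal.sum_ne_top.mpr fun _ _ => ENNReal.ofReal_ne_top)).bind
          fun i => run (c i)
      else PMF.pure none

open Classical in
/-- The worst-case number of steps over the reals, the maximum being over all outcomes of the
draws. Every instruction costs one step, except that a draw from `N` items costs `N + 1`. -/
noncomputable def steps : Comp ℝ α → ℕ
  | ret _ => 0
  | tick c => 1 + steps c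
  | int z c => 1 + steps (c z)
  | arith op x y c => 1 + steps (c (ArithOp.eval op x y))
  | pos x c => 1 + steps (c (decide (0 < x)))
  | draw N _ c => N + 1 + Finset.univ.sup fun i => steps (c i)

end Comp

/-! ## Elementary subroutines -/

section Algorithm

variable {R : Type}

def loadInt (z : ℤ) : Comp R R := .int z .ret
def addC (x y : R) : Comp R R := .arith .add x y .ret
def subC (x y : R) : Comp R R := .arith .sub x y .ret
def mulC (x y : R) : Comp R R := .arith .mul x y .ret
def divC (x y : R) : Comp R R := .arith .div x y .ret
def isPos (x : R) : Comp R Bool := .pos x .ret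
def drawC {N : ℕ} (w : Fin N → R) : Comp R (Fin N) := .draw N w .ret

/-- Compute and store a table with `N` entries. -/
def tabulate {α : Type} : (N : ℕ) → (Fin N → Comp R α) → Comp R (Fin N → α)
  | 0, _ => pure Fin.elim0
  | N + 1, f => .tick do
      let a ← f 0
      let rest ← tabulate N fun i => f i.succ
      pure (Fin.cons a rest : Fin (N + 1) → α)

/-- Run through a list, updating a state. -/
def loop {β σ : Type} : List β → σ → (β → σ → Comp R σ) → Comp R σ
  | [], s, _ => pure s
  | b :: bs, s, f => .tick do
      let s' ← f b s
      loop bs s' f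

/-- The sum of `f b` over the entries `b` of a list. -/
def sumC {β : Type} (bs : List β) (f : β → Comp R R) : Comp R R := do
  let zero ← loadInt 0
  loop bs zero fun b s => do
    let v ← f b
    addC s v

def dotC {n : ℕ} (u v : Fin n → R) : Comp R R :=
  sumC (List.finRange n) fun s => mulC (u s) (v s)

def absC (x : R) : Comp R R := do
  let b ← isPos x
  if b then pure x else do
    let zero ← loadInt 0
    subC zero x

/-- Compute `B Bᵀ`. -/
def gramC {m n : ℕ} (B : Matrix (Fin m) (Fin n) R) : Comp R (Matrix (Fin m) (Fin m) R) :=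
  tabulate m fun i => tabulate m fun j => dotC (B i) (B j)

/-- Project all rows of `B` orthogonally to the row `i`, where `q` is the squared length of this
row. -/
def projectC {m n : ℕ} (B : Matrix (Fin m) (Fin n) R) (i : Fin m) (q : R) :
    Comp R (Matrix (Fin m) (Fin n) R) :=
  tabulate m fun r => do
    let c ← dotC (B r) (B i)
    let c' ← divC c q
    tabulate n fun s => do
      let a ← mulC c' (B i s)
      subC (B r s) a

/-- The determinant by Gaussian elimination. No pivoting is done: it is used for positive definite
matrices only, and a vanishing pivot would make the computation crash. -/
def detC : (m : ℕ) → Matrix (Fin m) (Fin m) R → Comp R R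
  | 0, _ => loadInt 1
  | m + 1, M => do
      let M' ← tabulate m fun i => tabulate m fun j => do
        let a ← mulC (M i.succ 0) (M 0 j.succ)
        let b ← divC a (M 0 0)
        subC (M i.succ j.succ) b
      let d ← detC m M'
      mulC (M 0 0) d

/-! ## The coefficients by multivariate interpolation -/

/-- For the interpolation nodes `x_t = -(t + 1)`, `t = 0, …, d`, the list of the pairs `(x_t, w_t)`,
where `w_t` is the entry at `(e, t)` of the inverse of the Vandermonde matrix `(x_t ^ j)_{t, j}`,
that is, the coefficient of `x ^ e` in the `t`-th Lagrange polynomial. (It is zero for `d < e`.) -/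
def interpolationRule (d e : ℕ) : Comp R (List (R × R)) := do
  let X ← tabulate (d + 1) fun t => loadInt (-((t : ℕ) + 1 : ℤ))
  let W ← tabulate (d + 1) fun t => do
    let one ← loadInt 1
    let zero ← loadInt 0
    let start ← tabulate (d + 1) fun j => pure (if j = 0 then one else zero)
    let c ← loop (List.finRange (d + 1)) start fun s c =>
      if s = t then pure c else do
        let den ← subC (X t) (X s)
        tabulate (d + 1) fun j => do
          let a ← mulC (X s) (c j)
          let b ← subC (Fin.cases zero (fun i : Fin d => c i.castSucc) j) a
          divC b den
    if h : e < d + 1 then pure (X t, c ⟨e, h⟩) else pure (X t, zero)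
  pure (List.ofFn W)

/-- The sum of `w_1 ⋯ w_p * f (x_1, …, x_p)` over the grid of all choices of one pair `(x_l, w_l)`
from each of the lists. -/
def gridSum : (p : ℕ) → (Fin p → List (R × R)) → ((Fin p → R) → Comp R R) → Comp R R
  | 0, _, f => f Fin.elim0
  | p + 1, rules, f => sumC (rules 0) fun xw => do
      let v ← gridSum p (fun l => rules l.succ) fun x => f (Fin.cons xw.1 x : Fin (p + 1) → R)
      mulC xw.2 v

/-- The value of `det (G - x_1 I_1 - ⋯ - x_p I_p)` at a point. -/
def evalCharpolyC {m p : ℕ} (G : Matrix (Fin m) (Fin m) R) (part : Fin m → Fin p) (x : Fin p → R) :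
    Comp R R := do
  let M ← tabulate m fun i => tabulate m fun j =>
    if i = j then subC (G i j) (x (part i)) else pure (G i j)
  detC m M

/-- The coefficient `c_{e_1, …, e_p}` of `det (G - x_1 I_1 - ⋯ - x_p I_p)`, interpolated from the
values on the grid with `(m_1 + 1) ⋯ (m_p + 1)` points. -/
def coeffC {m p : ℕ} (G : Matrix (Fin m) (Fin m) R) (part : Fin m → Fin p) (sizes e : Fin p → ℕ) :
    Comp R R := do
  let rules ← tabulate p fun l => interpolationRule (sizes l) (e l)
  gridSum p rules fun x => evalCharpolyC G part x

/-! ## The sampling algorithm -/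

/-- The weight `p_i = ‖b_i‖² |c'(C_i C_iᵀ)|` of the item `i`, where `C_i` is `B` with all rows
projected orthogonally to `b_i`. (The weight is zero if `b_i = 0`.) -/
def weightC {m n p : ℕ} (part : Fin m → Fin p) (sizes k t : Fin p → ℕ)
    (B : Matrix (Fin m) (Fin n) R) (i : Fin m) : Comp R R := do
  let q ← dotC (B i) (B i)
  let b ← isPos q
  if b then do
    let C ← projectC B i q
    let G ← gramC C
    let e ← tabulate p fun l => pure (coeffIndex part sizes k t i l)
    let c ← coeffC G part sizes e
    let a ← absC c
    mulC q a
  else loadInt 0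

/-- The main loop: pick one item after the other, the item `i` with probability proportional to
`p_i`, and replace `B` by `C_i`. The picked items are returned in the order in which they were
picked. -/
def pickC {m n p : ℕ} (part : Fin m → Fin p) (sizes k : Fin p → ℕ) :
    ℕ → (Fin p → ℕ) → Matrix (Fin m) (Fin n) R → Comp R (List (Fin m))
  | 0, _, _ => pure []
  | r + 1, t, B => .tick do
      let w ← tabulate m fun i => weightC part sizes k t B i
      let i ← drawC w
      let q ← dotC (B i) (B i)
      let C ← projectC B i q
      let t' ← tabulate p fun l => pure (t l + if l = part i then 1 else 0)
      let rest ← pickC part sizes k r t' C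
      pure (i :: rest)

/-- The whole algorithm, with the items in the order in which they are picked. -/
def orderedSampler {m n p : ℕ} (A : Matrix (Fin m) (Fin n) R) (part : Fin m → Fin p)
    (k : Fin p → ℕ) : Comp R (List (Fin m)) := do
  let sizes ← tabulate p fun l =>
    loop (List.finRange m) 0 fun i c => pure (if part i = l then c + 1 else c)
  let total ← loop (List.finRange p) 0 fun l c => pure (c + k l)
  let t ← tabulate p fun _ => pure 0
  pickC part sizes k total t A

/-- The sampling algorithm for Partition-DPPs; it returns the set of the picked items. -/
def sampler {m n p : ℕ} (A : Matrix (Fin m) (Fin n) R) (part : Fin m → Fin p)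
    (k : Fin p → ℕ) : Comp R (Finset (Fin m)) := do
  let picked ← orderedSampler A part k
  loop picked ∅ fun i S => pure (insert i S)

end Algorithm

end PartitionDPP

namespace PartitionDPP

/-! ## Semantics of programs -/

namespace Comp

variable {α β γ : Type}

/-! Write `W(S)` for the total mass `extWeight A part k S` of the admissible sets containing `S`.
Everything follows from the two identities `det(A_S A_Sᵀ) * w_i = W(S ∪ {i})` for `i ∉ S` and `∑_{i
∉ S} W(S ∪ {i}) = (k - |S|) * W(S)`. They say that item `i` is drawn with probability `W(S ∪ {i}) /
((k - |S|) * W(S))`; the product of these probabilities along a sequence telescopes to `det(A_U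
A_Uᵀ) / (k! * W(∅))`, where `U` is the set of its items.

The second identity (`sum_extWeight_insert`) is a double count. The first (`gramDet_mul_itemWeight`)
rests on `extWeight_eq`, which has two ingredients. Gram determinants factor through orthogonal
projection, `gramDet A (S ∪ T) = gramDet A S * gramDet (residual A S) T` (`gramDet_union`). A
coefficient of the multivariate characteristic polynomial is a signed sum of principal minors whose
complements have prescribed part counts; for a Gram matrix there is no cancellation
(`abs_charCoeff_gram`).

The program computes these weights without crashing because the interpolation nodes are negative:
the matrices to be eliminated are positive definite, and so are all their Schur complements
(`posDef_schurStep`). Since the degree in `x_l` is at most `m_l`, the grid determines the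
coefficient (`evals_coeffC`).

The running time is dominated by one cubic elimination per grid point, per item and per round; AM-GM
bounds the number of grid points by `(1 + m/p)^p` (`prod_partSize_le`). -/

theorem andThen_assoc (c : Comp ℝ α) (f : α → Comp ℝ β) (g : β → Comp ℝ γ) :
    (c.andThen f).andThen g = c.andThen fun a => (f a).andThen g := by
  induction c with
  | ret a => rfl
  | tick c ih => simp only [andThen, ih]
  | int z c ih => simp only [andThen, ih]
  | arith op x y c ih => simp only [andThen, ih]
  | pos x c ih => simp only [andThen, ih]
  | draw N w c ih => simp only [andThen, ih]

theorem andThen_ret (c : Comp ℝ α) : c.andThen ret = c := by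
  induction c with
  | ret a => rfl
  | tick c ih => simp only [andThen, ih]
  | int z c ih => simp only [andThen, ih]
  | arith op x y c ih => simp only [andThen, ih]
  | pos x c ih => simp only [andThen, ih]
  | draw N w c ih => simp only [andThen, ih]

theorem run_andThen (c : Comp ℝ α) (g : α → Comp ℝ β) :
    (c.andThen g).run =
      c.run.bind fun o => o.elim (PMF.pure none) fun a => (g a).run := by
  induction c with
  | ret a => simp [andThen, run]
  | tick c ih => simp only [andThen, run, ih]
  | int z c ih => simp only [andThen, run, ih]
  | arith op x y c ih =>
    simp only [andThen, run]
    split_ifs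
    · simp
    · exact ih _
  | pos x c ih => simp only [andThen, run, ih]
  | draw N w c ih =>
    simp only [andThen, run]
    split_ifs
    · simp only [ih, PMF.bind_bind]
    · simp

/-- The computation returns `a` with certainty, and does not crash. -/
def Evals (c : Comp ℝ α) (a : α) : Prop := c.run = PMF.pure (some a)

theorem evals_pure (a : α) : Evals (pure a : Comp ℝ α) a := rfl

/-- The continuation may be random: this strips deterministic instructions off a program that draws
later on. -/
theorem Evals.run_bind {c : Comp ℝ α} {a : α} (h : Evals c a) (f : α → Comp ℝ β) :
    (c >>= f).run = (f a).run := by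
  change (c.andThen f).run = _
  rw [run_andThen, h]
  simp

theorem Evals.bind {c : Comp ℝ α} {a : α} (h : Evals c a) {f : α → Comp ℝ β} {b : β}
    (hf : Evals (f a) b) : Evals (c >>= f) b :=
  (h.run_bind f).trans hf

theorem Evals.tick {c : Comp ℝ α} {a : α} (h : Evals c a) : Evals (.tick c) a := h

theorem Evals.congr {c : Comp ℝ α} {a b : α} (h : Evals c a) (hab : a = b) : Evals c b :=
  hab ▸ h

theorem evals_loadInt (z : ℤ) : Evals (loadInt (z : ℤ) : Comp ℝ ℝ) (z : ℝ) := rfl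

theorem evals_addC (x y : ℝ) : Evals (addC x y) (x + y) := by
  simp [Evals, addC, run, ArithOp.eval]

theorem evals_subC (x y : ℝ) : Evals (subC x y) (x - y) := by
  simp [Evals, subC, run, ArithOp.eval]

theorem evals_mulC (x y : ℝ) : Evals (mulC x y) (x * y) := by
  simp [Evals, mulC, run, ArithOp.eval]

theorem evals_divC (x : ℝ) {y : ℝ} (hy : y ≠ 0) : Evals (divC x y) (x / y) := by
  simp [Evals, divC, run, ArithOp.eval, hy]

open Classical in
theorem evals_isPos (x : ℝ) : Evals (isPos x) (decide (0 < x)) := rfl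

theorem evals_tabulate {N : ℕ} {f : Fin N → Comp ℝ α} {v : Fin N → α}
    (h : ∀ i, Evals (f i) (v i)) : Evals (tabulate N f) v := by
  induction N with
  | zero => exact (evals_pure _).congr (Subsingleton.elim _ _)
  | succ N ih =>
    refine Evals.tick ((h 0).bind ((ih fun i => h i.succ).bind ((evals_pure _).congr ?_)))
    exact Fin.cons_self_tail v

theorem evals_loop {l : List β} {f : β → α → Comp ℝ α} {F : α → β → α}
    (h : ∀ b ∈ l, ∀ s, Evals (f b s) (F s b)) (s : α) : Evals (loop l s f) (l.foldl F s) := by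
  induction l generalizing s with
  | nil => exact evals_pure _
  | cons b l ih =>
    exact Evals.tick ((h b (by simp) s).bind (ih (fun c hc => h c (by simp [hc])) _))

theorem evals_sumC {l : List β} {f : β → Comp ℝ ℝ} {F : β → ℝ}
    (h : ∀ b ∈ l, Evals (f b) (F b)) : Evals (sumC l f) (l.map F).sum := by
  refine (evals_loadInt 0).bind ((evals_loop (F := fun s b => s + F b)
    (fun b hb s => (h b hb).bind (evals_addC _ _)) _).congr ?_)
  rw [← List.foldl_map (f := F) (g := fun s b => s + b), List.sum_eq_foldl]
  simp

theorem evals_dotC {n : ℕ} (u v : Fin n → ℝ) : Evals (dotC u v) (u ⬝ᵥ v) := by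
  refine (evals_sumC fun s _ => evals_mulC (u s) (v s)).congr ?_
  rw [dotProduct, Fin.sum_univ_def]

theorem evals_absC (x : ℝ) : Evals (absC x) |x| := by
  refine (evals_isPos x).bind ?_
  by_cases hx : 0 < x
  · simpa [hx, abs_of_pos hx] using evals_pure x
  · simp only [hx, decide_false, Bool.false_eq_true, if_false]
    refine (evals_loadInt 0).bind ((evals_subC _ _).congr ?_)
    simp [abs_of_nonpos (not_lt.mp hx)]

theorem evals_gramC {m n : ℕ} (B : Matrix (Fin m) (Fin n) ℝ) :
    Evals (gramC B) (B * B.transpose) :=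
  evals_tabulate fun _ => evals_tabulate fun _ => evals_dotC _ _

/-! ## Worst-case cost -/

/-- The computation takes at most `K` steps, and whatever the outcome of the draws, its result
satisfies `P`. -/
def CostsAtMost (c : Comp ℝ α) (P : α → Prop) (K : ℕ) : Prop :=
  ∀ (β : Type) (g : α → Comp ℝ β) (L : ℕ), (∀ a, P a → (g a).steps ≤ L) →
    (c.andThen g).steps ≤ K + L

theorem CostsAtMost.steps_le {c : Comp ℝ α} {P : α → Prop} {K : ℕ} (h : CostsAtMost c P K) :
    c.steps ≤ K := by
  have := h α ret 0 fun a _ => by simp [steps]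
  rwa [andThen_ret] at this

theorem CostsAtMost.mono {c : Comp ℝ α} {P Q : α → Prop} {K K' : ℕ} (h : CostsAtMost c P K)
    (hPQ : ∀ a, P a → Q a) (hK : K ≤ K') : CostsAtMost c Q K' := fun β g L hg =>
  (h β g L fun a ha => hg a (hPQ a ha)).trans (by omega)

theorem costs_pure {P : α → Prop} {a : α} (h : P a) : CostsAtMost (pure a : Comp ℝ α) P 0 :=
  fun _ _ L hg => (hg a h).trans_eq (zero_add L).symm

/-- Because `CostsAtMost` quantifies over continuations, composition is just associativity, and the
maximum over the outcomes of draws never has to be split. -/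
theorem CostsAtMost.bind {c : Comp ℝ α} {f : α → Comp ℝ β} {P : α → Prop} {Q : β → Prop}
    {K K' : ℕ} (h : CostsAtMost c P K) (hf : ∀ a, P a → CostsAtMost (f a) Q K') :
    CostsAtMost (c >>= f) Q (K + K') := fun γ g L hg => by
  change ((c.andThen f).andThen g).steps ≤ _
  rw [andThen_assoc, add_assoc]
  exact h γ _ _ fun a ha => hf a ha γ g L hg

theorem CostsAtMost.tick {c : Comp ℝ α} {P : α → Prop} {K : ℕ} (h : CostsAtMost c P K) :
    CostsAtMost (.tick c) P (K + 1) := fun β g L hg => by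
  have := h β g L hg
  simp only [andThen, steps]
  omega

theorem costs_loadInt (z : ℤ) : CostsAtMost (loadInt z) (fun _ => True) 1 := fun _ _ _ hg => by
  simpa [loadInt, andThen, steps] using hg _ trivial

theorem costs_addC (x y : ℝ) : CostsAtMost (addC x y) (fun _ => True) 1 := fun _ _ _ hg => by
  simpa [addC, andThen, steps] using hg _ trivial

theorem costs_subC (x y : ℝ) : CostsAtMost (subC x y) (fun _ => True) 1 := fun _ _ _ hg => by
  simpa [subC, andThen, steps] using hg _ trivial

theorem costs_mulC (x y : ℝ) : CostsAtMost (mulC x y) (fun _ => True) 1 := fun _ _ _ hg => by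
  simpa [mulC, andThen, steps] using hg _ trivial

theorem costs_divC (x y : ℝ) : CostsAtMost (divC x y) (fun _ => True) 1 := fun _ _ _ hg => by
  simpa [divC, andThen, steps] using hg _ trivial

theorem costs_isPos (x : ℝ) : CostsAtMost (isPos x) (fun _ => True) 1 := fun _ _ _ hg => by
  simpa [isPos, andThen, steps] using hg _ trivial

theorem costs_drawC {N : ℕ} (w : Fin N → ℝ) :
    CostsAtMost (drawC w) (fun _ => True) (N + 1) := fun _ g L hg => by
  simp only [drawC, andThen, steps]
  gcongr
  exact Finset.sup_le fun i _ => hg i trivial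

theorem costs_tabulate_sum {N : ℕ} {f : Fin N → Comp ℝ α} {P : Fin N → α → Prop} {K : Fin N → ℕ}
    (h : ∀ i, CostsAtMost (f i) (P i) (K i)) :
    CostsAtMost (tabulate N f) (fun v => ∀ i, P i (v i)) (∑ i, (K i + 1)) := by
  induction N with
  | zero => exact costs_pure fun i => i.elim0
  | succ N ih =>
    rw [Fin.sum_univ_succ]
    refine (CostsAtMost.tick ((h 0).bind fun a ha => (ih fun i => h i.succ).bind fun v hv =>
      costs_pure ?_)).mono (fun _ h => h) (by omega)
    intro i
    cases i using Fin.cases with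
    | zero => exact ha
    | succ i => exact hv i

theorem costs_tabulate {N : ℕ} {f : Fin N → Comp ℝ α} {P : Fin N → α → Prop} {K : ℕ}
    (h : ∀ i, CostsAtMost (f i) (P i) K) :
    CostsAtMost (tabulate N f) (fun v => ∀ i, P i (v i)) (N * (K + 1)) :=
  (costs_tabulate_sum h).mono (fun _ h => h) (by simp)

theorem costs_loop {l : List β} {f : β → α → Comp ℝ α} {P : α → Prop} {K : ℕ}
    (h : ∀ b s, P s → CostsAtMost (f b s) P K) {s : α} (hs : P s) :
    CostsAtMost (loop l s f) P (l.length * (K + 1)) := by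
  induction l generalizing s with
  | nil => exact (costs_pure hs).mono (fun _ h => h) (by simp)
  | cons b l ih =>
    refine (CostsAtMost.tick ((h b s hs).bind fun s' hs' => ih hs')).mono (fun _ h => h) ?_
    simp only [List.length_cons]
    linarith

/-- Unlike `costs_loop`, this keeps the exact final state. The part sizes and the number of rounds
are computed by such loops, and later costs depend on their values. -/
theorem costs_loop_pure (l : List β) (F : α → β → α) (s : α) :
    CostsAtMost (loop l s fun b s => pure (F s b)) (· = l.foldl F s) l.length := by
  induction l generalizing s with
  | nil => exact costs_pure rfl
  | cons b l ih =>
    refine (CostsAtMost.tick ((costs_pure (P := (· = F s b)) rfl).bind fun s' hs' => ?_)).mono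
      (fun _ h => h) (K := (0 + l.length) + 1) (by simp)
    subst hs'
    exact ih _

theorem costs_sumC {l : List β} {f : β → Comp ℝ ℝ} {K : ℕ}
    (h : ∀ b, CostsAtMost (f b) (fun _ => True) K) :
    CostsAtMost (sumC l f) (fun _ => True) (1 + l.length * (K + 2)) :=
  (costs_loadInt 0).bind fun _ _ => costs_loop (K := K + 1)
    (fun b _ _ => (h b).bind fun _ _ => costs_addC _ _) trivial

theorem costs_dotC {n : ℕ} (u v : Fin n → ℝ) :
    CostsAtMost (dotC u v) (fun _ => True) (1 + n * 3) :=
  (costs_sumC fun _ => costs_mulC _ _).mono (fun _ h => h) (by simp)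

theorem costs_absC (x : ℝ) : CostsAtMost (absC x) (fun _ => True) 3 :=
  (costs_isPos x).bind (K' := 2) fun b _ => by
    cases b
    · exact (costs_loadInt 0).bind fun _ _ => costs_subC _ _
    · exact (costs_pure trivial).mono (fun _ h => h) (by omega)

/-! ### Costs of linear algebra and interpolation -/

theorem costs_gramC {m n : ℕ} (B : Matrix (Fin m) (Fin n) ℝ) :
    CostsAtMost (gramC B) (fun _ => True) (m * (m * (3 * n + 2) + 1)) :=
  (costs_tabulate fun _ => costs_tabulate fun _ => costs_dotC _ _).mono (fun _ _ => trivial)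
    (by ring_nf; rfl)

theorem costs_projectC {m n : ℕ} (B : Matrix (Fin m) (Fin n) ℝ) (i : Fin m) (q : ℝ) :
    CostsAtMost (projectC B i q) (fun _ => True) (m * (6 * n + 3)) :=
  (costs_tabulate (K := 6 * n + 2) (P := fun _ _ => True) fun _ =>
    ((costs_dotC _ _).bind fun _ _ => (costs_divC _ _).bind fun _ _ =>
      costs_tabulate fun _ => (costs_mulC _ _).bind fun _ _ => costs_subC _ _).mono
        (fun _ _ => trivial) (by omega)).mono (fun _ _ => trivial) le_rfl

theorem costs_detC (m : ℕ) (M : Matrix (Fin m) (Fin m) ℝ) :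
    CostsAtMost (detC m M) (fun _ => True) (m * (4 * m ^ 2 + 2) + 1) := by
  induction m with
  | zero => exact costs_loadInt 1
  | succ m ih =>
    refine ((costs_tabulate fun _ => costs_tabulate fun _ => (costs_mulC _ _).bind fun _ _ =>
      (costs_divC _ _).bind fun _ _ => costs_subC _ _).bind fun M' _ => (ih M').bind fun _ _ =>
        costs_mulC _ _).mono (fun _ h => h) ?_
    nlinarith

theorem costs_evalCharpolyC {m p : ℕ} (G : Matrix (Fin m) (Fin m) ℝ) (part : Fin m → Fin p)
    (x : Fin p → ℝ) :
    CostsAtMost (evalCharpolyC G part x) (fun _ => True) (m * (4 * m ^ 2 + 2 * m + 3) + 1) :=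
  ((costs_tabulate fun i => costs_tabulate (P := fun _ _ => True) (K := 1) fun j => by
    split_ifs
    · exact costs_subC _ _
    · exact (costs_pure trivial).mono (fun _ h => h) (by omega)).bind fun M _ =>
      costs_detC m M).mono (fun _ h => h) (by nlinarith)

theorem costs_interpolationRule (d e : ℕ) :
    CostsAtMost (interpolationRule d e : Comp ℝ _) (fun l => l.length = d + 1)
      (14 * (d + 1) ^ 3) := by
  refine ((costs_tabulate (P := fun _ _ => True) fun _ => costs_loadInt _).bind fun X _ =>
    (costs_tabulate (P := fun _ _ => True) (K := 2 + (d + 1) + (d + 1) * ((d + 1) * 4 + 2))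
      fun t => ?_).bind fun W _ =>
      costs_pure (P := fun l : List (ℝ × ℝ) => l.length = d + 1) (by simp)).mono
        (fun _ h => h) ?_
  · refine ((costs_loadInt 1).bind fun one _ => (costs_loadInt 0).bind fun zero _ =>
      (costs_tabulate (P := fun _ _ => True) (K := 0) fun j => costs_pure trivial).bind fun _ _ =>
      (costs_loop (P := fun _ => True) (K := (d + 1) * 4 + 1) (fun s c _ => ?_) trivial).bind
        (K' := 0) fun c _ => ?_).mono (fun _ h => h) ?_
    · split_ifs
      · exact (costs_pure trivial).mono (fun _ h => h) (by omega)
      · exact ((costs_subC _ _).bind fun den _ => (costs_tabulate (P := fun _ _ => True)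
          fun j => (costs_mulC _ _).bind fun _ _ => (costs_subC _ _).bind fun _ _ =>
            costs_divC _ _)).mono (fun _ _ => trivial) (by omega)
    · split_ifs <;> exact costs_pure trivial
    · simp only [List.length_finRange]
      linarith
  -- With `D = d + 1` the total is `4D³ + 3D² + 5D`.
  · nlinarith [sq_nonneg d, Nat.zero_le (d ^ 3)]

/-- A level with `N` nodes above a grid of `Q` points adds `1 + 3N ≤ 4NQ` steps, which accounts for
`4 * p`. Nonempty lists are needed for this absorption. -/
theorem costs_gridSum (p : ℕ) (rules : Fin p → List (ℝ × ℝ)) (f : (Fin p → ℝ) → Comp ℝ ℝ) {K : ℕ}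
    (hf : ∀ x, CostsAtMost (f x) (fun _ => True) K) (hr : ∀ l, 1 ≤ (rules l).length) :
    CostsAtMost (gridSum p rules f) (fun _ => True)
      ((∏ l, (rules l).length) * (K + 4 * p)) := by
  induction p with
  | zero => exact (hf _).mono (fun _ h => h) (by simp)
  | succ p ih =>
    refine (costs_sumC fun xw => (ih _ _ (fun x => hf _) fun l => hr l.succ).bind fun v _ =>
      costs_mulC _ _).mono (fun _ h => h) ?_
    rw [Fin.prod_univ_succ]
    have h1 : 1 ≤ ∏ l : Fin p, (rules l.succ).length := Finset.one_le_prod' fun l _ => hr _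
    have h0 := hr 0
    generalize ∏ l : Fin p, (rules l.succ).length = Q at *
    generalize (rules 0).length = N at *
    have : N ≤ N * Q := Nat.le_mul_of_pos_right _ h1
    nlinarith

end Comp

end PartitionDPP

namespace PartitionDPP

open Matrix

/-! ## Counting elements of the parts -/

section PartCount

variable {m p : ℕ} (part : Fin m → Fin p)

theorem partCount_insert {S : Finset (Fin m)} {i : Fin m} (hi : i ∉ S) (l : Fin p) :
    partCount part (insert i S) l = partCount part S l + if l = part i then 1 else 0 := by
  unfold partCount
  rw [Finset.filter_insert]
  by_cases h : part i = l
  · rw [if_pos h, if_pos h.symm, Finset.card_insert_of_notMem (by simp [hi])]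
  · rw [if_neg h, if_neg (Ne.symm h), add_zero]

theorem partCount_union {S T : Finset (Fin m)} (h : Disjoint S T) (l : Fin p) :
    partCount part (S ∪ T) l = partCount part S l + partCount part T l := by
  unfold partCount
  rw [Finset.filter_union, Finset.card_union_of_disjoint (Finset.disjoint_filter_filter h)]

theorem partCount_add_compl (S : Finset (Fin m)) (l : Fin p) :
    partCount part S l + partCount part Sᶜ l = partSize part l := by
  rw [← partCount_union part disjoint_compl_right, Finset.union_compl]
  rfl

theorem partCount_mono {S T : Finset (Fin m)} (h : S ⊆ T) (l : Fin p) :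
    partCount part S l ≤ partCount part T l :=
  Finset.card_le_card (Finset.filter_subset_filter _ h)

theorem sum_partCount (S : Finset (Fin m)) : ∑ l, partCount part S l = S.card :=
  (Finset.card_eq_sum_card_fiberwise (f := part) (t := Finset.univ) fun _ _ => by simp).symm

theorem sum_partSize : ∑ l, partSize part l = m :=
  (sum_partCount part Finset.univ).trans (by simp)

end PartCount

/-! ## The coefficients of the multivariate characteristic polynomial -/

/-- Multilinearity in the rows: `S` records which rows are taken from `M`, the others coming from
`-diagonal d`. -/
theorem det_sub_diagonal {ι R : Type*} [Fintype ι] [DecidableEq ι] [CommRing R]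
    (M : Matrix ι ι R) (d : ι → R) :
    (M - diagonal d).det =
      ∑ S : Finset ι, (∏ i ∈ Sᶜ, -d i) * (M.submatrix (Subtype.val : S → ι) Subtype.val).det := by
  have h := (detRowAlternating : (ι → R) [⋀^ι]→ₗ[R] R).map_add_univ M (-diagonal d)
  rw [sub_eq_add_neg]
  refine h.trans (Finset.sum_congr rfl fun S _ => ?_)
  rw [← det_piecewise_one_eq_submatrix_det]
  -- The rows outside `S` are multiples of unit vectors. Once the scalars are pulled out, identity
  -- rows remain there, and the determinant is a principal minor.
  have h' : S.piecewise M (-diagonal d) = fun i => (if i ∈ Sᶜ then -d i else 1) •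
      (S.piecewise M.row (1 : Matrix ι ι R).row) i := by
    ext i j
    by_cases hi : i ∈ S
    · simp only [Finset.piecewise, hi, Finset.mem_compl, not_true_eq_false, if_true, if_false,
        one_smul]
      rfl
    · simp only [Finset.piecewise, hi, Finset.mem_compl, not_false_eq_true, if_true, if_false,
        Pi.smul_apply, row, one_apply, smul_eq_mul, mul_ite, mul_one,
        mul_zero]
      change -(if i = j then d i else 0) = _
      rw [apply_ite Neg.neg, neg_zero]
  rw [h', AlternatingMap.map_smul_univ, Finset.prod_ite_mem, Finset.univ_inter, smul_eq_mul]
  rfl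

section CharCoeff

variable {m n p : ℕ} (part : Fin m → Fin p)

theorem prod_neg_X (T : Finset (Fin m)) :
    ∏ i ∈ T, -(MvPolynomial.X (part i) : MvPolynomial (Fin p) ℝ) =
      MvPolynomial.monomial (Finsupp.equivFunOnFinite.symm (partCount part T)) ((-1) ^ T.card) := by
  induction T using Finset.induction_on with
  | empty =>
    have : Finsupp.equivFunOnFinite.symm (partCount part ∅) = 0 := by ext l; simp [partCount]
    rw [this]; simp
  | insert i T hi ih =>
    rw [Finset.prod_insert hi, ih, MvPolynomial.X, ← map_neg, MvPolynomial.monomial_mul,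
      Finset.card_insert_of_notMem hi, pow_succ']
    congr 2
    ext l
    simp [partCount_insert part hi, Finsupp.single_apply, add_comm, eq_comm]

/-- In the expansion `det_sub_diagonal` each `S` contributes a single monomial, whose exponents
count the elements of `Sᶜ` in each part. -/
theorem charCoeff_eq_sum (M : Matrix (Fin m) (Fin m) ℝ) (e : Fin p → ℕ) :
    charCoeff M part e =
      ∑ S : Finset (Fin m), if partCount part Sᶜ = e then
        (-1) ^ Sᶜ.card * (M.submatrix (Subtype.val : S → Fin m) Subtype.val).det else 0 := by
  classical
  rw [charCoeff, mvCharpoly, det_sub_diagonal, MvPolynomial.coeff_sum]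
  refine Finset.sum_congr rfl fun S _ => ?_
  have : ((M.map (MvPolynomial.C (σ := Fin p))).submatrix (Subtype.val : S → Fin m)
      Subtype.val).det = MvPolynomial.C
        (M.submatrix (Subtype.val : S → Fin m) Subtype.val).det := by
    rw [RingHom.map_det]; rfl
  rw [this, prod_neg_X, mul_comm, MvPolynomial.C_mul_monomial, MvPolynomial.coeff_monomial]
  have h : Finsupp.equivFunOnFinite.symm (partCount part Sᶜ) =
      Finsupp.equivFunOnFinite.symm e ↔ partCount part Sᶜ = e :=
    Finsupp.equivFunOnFinite.symm.apply_eq_iff_eq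
  simp only [h, mul_comm]

/-- This degree bound is what makes `m_l + 1` nodes in direction `l` sufficient. -/
theorem le_partSize_of_mem_support (M : Matrix (Fin m) (Fin m) ℝ) {e : Fin p →₀ ℕ}
    (he : e ∈ (mvCharpoly M part).support) (l : Fin p) : e l ≤ partSize part l := by
  rw [MvPolynomial.mem_support_iff, ← Finsupp.equivFunOnFinite.symm_apply_apply e] at he
  change charCoeff M part e ≠ 0 at he
  rw [charCoeff_eq_sum] at he
  obtain ⟨S, -, hS⟩ := Finset.exists_ne_zero_of_sum_ne_zero he
  have h : partCount part Sᶜ = e := by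
    by_contra h
    simp [h] at hS
  rw [← h]
  exact partCount_mono part (Finset.subset_univ _) l

theorem gramDet_nonneg (B : Matrix (Fin m) (Fin n) ℝ) (S : Finset (Fin m)) : 0 ≤ gramDet B S := by
  have h := (posSemidef_self_mul_conjTranspose
    (B.submatrix (Subtype.val : S → Fin m) id)).det_nonneg
  rwa [conjTranspose_eq_transpose_of_trivial] at h

/-- All contributing minors carry the same sign `(-1) ^ ∑ l, e l`, since `Sᶜ` has `∑ l, e l`
elements, and Gram minors are nonnegative. -/
theorem abs_charCoeff_gram (B : Matrix (Fin m) (Fin n) ℝ) (e : Fin p → ℕ) :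
    |charCoeff (B * Bᵀ) part e| =
      ∑ S : Finset (Fin m), if partCount part Sᶜ = e then gramDet B S else 0 := by
  have h : charCoeff (B * Bᵀ) part e = (-1) ^ (∑ l, e l) *
      ∑ S : Finset (Fin m), if partCount part Sᶜ = e then gramDet B S else 0 := by
    rw [charCoeff_eq_sum, Finset.mul_sum]
    refine Finset.sum_congr rfl fun S _ => ?_
    by_cases hS : partCount part Sᶜ = e
    · rw [if_pos hS, if_pos hS, ← hS, sum_partCount]
      rfl
    · rw [if_neg hS, if_neg hS, mul_zero]
  rw [h, abs_mul, abs_pow, abs_neg, abs_one, one_pow, one_mul, abs_of_nonneg]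
  refine Finset.sum_nonneg fun S _ => ?_
  split_ifs
  exacts [gramDet_nonneg B S, le_rfl]

end CharCoeff

/-! ## Projections and Gram determinants -/

section Projection

variable {m n p : ℕ}

/-- The rows of `B` projected orthogonally to the row `i`. -/
noncomputable def projectRows (B : Matrix (Fin m) (Fin n) ℝ) (i : Fin m) :
    Matrix (Fin m) (Fin n) ℝ :=
  of fun r s => B r s - B r ⬝ᵥ B i / (B i ⬝ᵥ B i) * B i s

theorem gramDet_eq_det {κ : Type*} [Fintype κ] [DecidableEq κ] (B : Matrix (Fin m) (Fin n) ℝ)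
    (S : Finset (Fin m)) (e : κ ≃ S) :
    gramDet B S = (of fun a b : κ => B (e a) ⬝ᵥ B (e b)).det := by
  rw [gramDet, ← det_submatrix_equiv_self e]
  rfl

theorem gramDet_eq_zero {B : Matrix (Fin m) (Fin n) ℝ} {S : Finset (Fin m)} {i : Fin m}
    (hi : i ∈ S) (h : B i = 0) : gramDet B S = 0 := by
  rw [gramDet_eq_det B S (Equiv.refl _)]
  exact det_eq_zero_of_row_eq_zero ⟨i, hi⟩ fun j => by simp [h]

/-- Schur complement with respect to the diagonal entry of row `i`: it is the Gram matrix of the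
rows of `U` projected orthogonally to that row. -/
theorem gramDet_insert (B : Matrix (Fin m) (Fin n) ℝ) {U : Finset (Fin m)} {i : Fin m}
    (hi : i ∉ U) : gramDet B (insert i U) = (B i ⬝ᵥ B i) * gramDet (projectRows B i) U := by
  -- The block formula needs an invertible corner; for a zero row both sides vanish.
  by_cases h0 : B i = 0
  · rw [gramDet_eq_zero (Finset.mem_insert_self i U) h0, h0]
    simp
  have hq : B i ⬝ᵥ B i ≠ 0 := fun h => h0 (dotProduct_self_eq_zero.mp h)
  let e : U ⊕ Unit ≃ (insert i U : Finset (Fin m)) :=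
    (Equiv.optionEquivSumPUnit _).symm.trans (Finset.subtypeInsertEquivOption hi).symm
  rw [gramDet_eq_det B _ e, gramDet_eq_det _ U (Equiv.refl _)]
  have hb : (of fun a b => B (e a) ⬝ᵥ B (e b)) = fromBlocks
      (of fun a b : U => B a ⬝ᵥ B b) (of fun (a : U) (_ : Unit) => B a ⬝ᵥ B i)
      (of fun (_ : Unit) (b : U) => B i ⬝ᵥ B b)
      (of fun (_ _ : Unit) => B i ⬝ᵥ B i) := by
    ext (a | a) (b | b) <;> rfl
  have hD : IsUnit (of fun (_ _ : Unit) => B i ⬝ᵥ B i) := by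
    rw [isUnit_iff_isUnit_det]
    simpa [det_unique] using hq
  let := hD.invertible
  rw [hb, det_fromBlocks₂₂, det_unique]
  have hinv : ⅟(of fun (_ _ : Unit) => B i ⬝ᵥ B i) = of fun _ _ => (B i ⬝ᵥ B i)⁻¹ := by
    refine invOf_eq_right_inv ?_
    ext a b
    simp [mul_apply, hq]
  rw [hinv]
  congr 2
  ext a b
  have h1 : ∀ r, projectRows B i r = B r - (B r ⬝ᵥ B i / (B i ⬝ᵥ B i)) • B i := fun r => by
    ext s; simp [projectRows]
  simp only [Matrix.sub_apply, of_apply, mul_apply, Equiv.refl_apply, h1, sub_dotProduct, dotProduct_sub,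
    smul_dotProduct, dotProduct_smul, smul_eq_mul, Finset.univ_unique, Finset.sum_singleton,
    dotProduct_comm (B i) (B b)]
  field_simp
  ring

theorem residual_empty (A : Matrix (Fin m) (Fin n) ℝ) : residual A ∅ = A := by
  ext r s
  simp [residual]

theorem residual_apply_mem (A : Matrix (Fin m) (Fin n) ℝ) {S : Finset (Fin m)} {i : Fin m}
    (hi : i ∈ S) : residual A S i = 0 := by
  ext s
  have : (WithLp.toLp 2 (A i) : EuclideanSpace ℝ (Fin n)) ∈ Submodule.span ℝ
      ((fun i => (WithLp.toLp 2 (A i) : EuclideanSpace ℝ (Fin n))) '' S) :=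
    Submodule.subset_span ⟨i, hi, rfl⟩
  simp [residual, Submodule.starProjection_eq_self_iff.mpr this]

/-- A Gram–Schmidt step: adjoining row `i` enlarges the span by the direction of its residual `b`,
which is orthogonal to the old span, so the projection gains the component along `b`. This
identifies the matrix kept by the algorithm with `A - π_S(A)`. -/
theorem residual_insert (A : Matrix (Fin m) (Fin n) ℝ) (S : Finset (Fin m)) (i : Fin m) :
    residual A (insert i S) = projectRows (residual A S) i := by
  set V : Fin m → EuclideanSpace ℝ (Fin n) := fun r => WithLp.toLp 2 (A r) with hV
  set K := Submodule.span ℝ (V '' S) with hK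
  set K' := Submodule.span ℝ (V '' (insert i S : Finset (Fin m))) with hK'
  have hres : ∀ r, residual A S r = WithLp.ofLp (V r - K.starProjection (V r)) := fun r => rfl
  have hres' : ∀ r, residual A (insert i S) r = WithLp.ofLp (V r - K'.starProjection (V r)) :=
    fun r => rfl
  have hKK' : K ≤ K' := Submodule.span_mono (Set.image_mono (by simp))
  have hi : V i ∈ K' := Submodule.subset_span ⟨i, by simp, rfl⟩
  set b := V i - K.starProjection (V i) with hb
  have hbK' : b ∈ K' := K'.sub_mem hi (hKK' (K.starProjection_apply_mem _))
  have hdot : ∀ x y : EuclideanSpace ℝ (Fin n), WithLp.ofLp x ⬝ᵥ WithLp.ofLp y = inner ℝ x y :=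
    fun x y => by
      rw [EuclideanSpace.inner_eq_star_dotProduct, star_trivial, dotProduct_comm]
  have key : ∀ r, K'.starProjection (V r) = K.starProjection (V r) +
      ((residual A S r ⬝ᵥ residual A S i) / (residual A S i ⬝ᵥ residual A S i)) • b := by
    intro r
    rw [hres r, hres i, hdot, hdot, ← hb]
    set c := inner ℝ (V r - K.starProjection (V r)) b / inner ℝ b b with hc
    have hcb : inner ℝ (V r - (K.starProjection (V r) + c • b)) b = 0 := by
      rw [← sub_sub, inner_sub_left, inner_smul_left, hc]
      -- `b = 0` means that row `i` already lies in the old span; the added term `c • b` is then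
      -- zero whatever the value of the quotient.
      by_cases h0 : b = 0
      · simp [h0]
      · have : inner ℝ b b ≠ 0 := inner_self_ne_zero.mpr h0
        simp only [conj_trivial]
        field_simp
        ring
    have hK0 : ∀ w ∈ K, inner ℝ (V r - (K.starProjection (V r) + c • b)) w = 0 := fun w hw => by
      rw [← sub_sub, inner_sub_left, inner_smul_left, K.starProjection_inner_eq_zero _ _ hw, hb,
        K.starProjection_inner_eq_zero _ _ hw]
      simp
    refine Submodule.eq_starProjection_of_mem_of_inner_eq_zero
      (K'.add_mem (hKK' (K.starProjection_apply_mem _)) (K'.smul_mem _ hbK')) fun w hw => ?_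
    -- Orthogonality to `K'` need only be checked on the generators: the rows in `S` and row `i = b
    -- + ` its projection to `K`.
    have hle : K' ≤ (Submodule.span ℝ {V r - (K.starProjection (V r) + c • b)})ᗮ := by
      rw [hK', Submodule.span_le]
      rintro _ ⟨j, hj, rfl⟩
      rw [SetLike.mem_coe, Submodule.mem_orthogonal_singleton_iff_inner_right]
      rcases Finset.mem_insert.mp (Finset.mem_coe.mp hj) with rfl | hj
      · have : V j = b + K.starProjection (V j) := by rw [hb]; abel
        rw [this, inner_add_right, hcb, hK0 _ (K.starProjection_apply_mem _), add_zero]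
      · exact hK0 _ (Submodule.subset_span ⟨j, hj, rfl⟩)
    exact (Submodule.mem_orthogonal_singleton_iff_inner_right).mp (hle hw)
  ext r s
  rw [hres', key]
  simp only [projectRows, of_apply, hres r, hres i, ← hb, WithLp.ofLp_sub, WithLp.ofLp_add,
    WithLp.ofLp_smul, Pi.sub_apply, Pi.add_apply, Pi.smul_apply, smul_eq_mul]
  ring

/-- Iterates `gramDet_insert`: in the induction, `j` is moved from the first set to the second. -/
theorem gramDet_union (A : Matrix (Fin m) (Fin n) ℝ) (S T : Finset (Fin m)) (hT : Disjoint S T) :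
    gramDet A (S ∪ T) = gramDet A S * gramDet (residual A S) T := by
  induction S using Finset.induction_on generalizing T with
  | empty => rw [residual_empty, gramDet_empty]; simp
  | insert j S hj ih =>
    rw [Finset.disjoint_insert_left] at hT
    rw [Finset.insert_union, ← Finset.union_insert,
      ih (insert j T) (Finset.disjoint_insert_right.mpr ⟨hj, hT.2⟩), gramDet_insert _ hT.1,
      ← residual_insert, ← mul_assoc]
    -- What remains is the factorization of `gramDet A (insert j S)`, the induction hypothesis for
    -- the singleton `{j}`.
    congr 1
    have := ih (insert j ∅) (by simpa using hj)
    rwa [gramDet_insert _ (Finset.notMem_empty j), gramDet_empty, mul_one,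
      Finset.union_insert, Finset.union_empty, eq_comm] at this

theorem gramDet_insert_residual (A : Matrix (Fin m) (Fin n) ℝ) {S : Finset (Fin m)} {i : Fin m}
    (hi : i ∉ S) :
    gramDet A (insert i S) = gramDet A S * (residual A S i ⬝ᵥ residual A S i) := by
  have := gramDet_union A S (insert i ∅) (by simpa using hi)
  rwa [gramDet_insert _ (Finset.notMem_empty i), gramDet_empty, mul_one,
    Finset.union_insert, Finset.union_empty] at this

end Projection

end PartitionDPP

namespace PartitionDPP

open Matrix PartitionDPP.Comp

/-! ## Gaussian elimination -/

section Elimination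

/-- The matrix that remains after the first step of Gaussian elimination. -/
noncomputable def schurStep {m : ℕ} (M : Matrix (Fin (m + 1)) (Fin (m + 1)) ℝ) :
    Matrix (Fin m) (Fin m) ℝ :=
  of fun i j => M i.succ j.succ - M i.succ 0 * M 0 j.succ / M 0 0

theorem det_eq_mul_det_schurStep {m : ℕ} (M : Matrix (Fin (m + 1)) (Fin (m + 1)) ℝ)
    (h : M 0 0 ≠ 0) : M.det = M 0 0 * (schurStep M).det := by
  -- `M` after the row operations that clear column `0` below the pivot.
  let N : Matrix (Fin (m + 1)) (Fin (m + 1)) ℝ :=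
    of fun i j => Fin.cases (M 0 j) (fun i => M i.succ j - M i.succ 0 / M 0 0 * M 0 j) i
  have hN : M.det = N.det := by
    refine det_eq_of_forall_row_eq_smul_add_const
      (Fin.cases 0 fun i => M i.succ 0 / M 0 0) 0 rfl fun i j => ?_
    cases i using Fin.cases <;> simp [N]
  rw [hN, det_succ_column_zero, Fin.sum_univ_succ, Finset.sum_eq_zero]
  · have : N.submatrix (Fin.succAbove 0) Fin.succ = schurStep M := by
      ext i j
      simp only [N, schurStep, submatrix_apply, of_apply, Fin.zero_succAbove, Fin.cases_succ]
      ring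
    rw [this]
    simp [N]
  · intro i _
    have : N i.succ 0 = 0 := by
      simp only [N, of_apply, Fin.cases_succ]
      field_simp
      ring
    simp [this]

/-- The Schur complement is the congruence `Nᵀ M N`, where `N` has the row `-(M 0 j / M 0 0)` on top
of an identity block and is therefore injective. Hence all later pivots are positive as well. -/
theorem posDef_schurStep {m : ℕ} {M : Matrix (Fin (m + 1)) (Fin (m + 1)) ℝ} (h : M.PosDef) :
    (schurStep M).PosDef := by
  have h0 : M 0 0 ≠ 0 := h.diag_pos.ne'
  let N : Matrix (Fin (m + 1)) (Fin m) ℝ :=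
    of fun i j => Fin.cases (-(M 0 j.succ / M 0 0)) (fun i => (1 : Matrix (Fin m) (Fin m) ℝ) i j) i
  have hinj : Function.Injective N.mulVec := by
    intro x y hxy
    ext i
    have := congrFun hxy i.succ
    simpa [N, mulVec, dotProduct, one_apply] using this
  convert! h.conjTranspose_mul_mul_same hinj using 1
  have h1 : ∀ i j, (M * N) i j = - (M i 0 * (M 0 j.succ / M 0 0)) + M i j.succ := fun i j => by
    rw [mul_apply, Fin.sum_univ_succ]
    simp [N, one_apply]
  ext i j
  rw [Matrix.mul_assoc, mul_apply, Fin.sum_univ_succ]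
  simp only [h1, conjTranspose_apply, star_trivial]
  -- Row `0` of `M * N` vanishes, so only the identity block of `Nᵀ` contributes.
  have h2 : -(M 0 0 * (M 0 j.succ / M 0 0)) + M 0 j.succ = 0 := by
    field_simp
    ring
  rw [h2]
  simp only [N, schurStep, of_apply, Fin.cases_succ, one_apply, ite_mul, one_mul, zero_mul,
    Finset.sum_ite_eq', Finset.mem_univ, if_true]
  ring

theorem evals_detC {m : ℕ} {M : Matrix (Fin m) (Fin m) ℝ} (h : M.PosDef) :
    Evals (detC m M) M.det := by
  induction m with
  | zero => exact (evals_loadInt 1).congr (by simp)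
  | succ m ih =>
    have h0 : M 0 0 ≠ 0 := h.diag_pos.ne'
    rw [det_eq_mul_det_schurStep M h0]
    exact (evals_tabulate (v := schurStep M) fun i => evals_tabulate fun j =>
      (evals_mulC _ _).bind ((evals_divC _ h0).bind (evals_subC _ _))).bind
        ((ih (posDef_schurStep h)).bind (evals_mulC _ _))

theorem eval_mvCharpoly {m p : ℕ} (G : Matrix (Fin m) (Fin m) ℝ) (part : Fin m → Fin p)
    (x : Fin p → ℝ) :
    MvPolynomial.eval x (mvCharpoly G part) = (G - diagonal fun i => x (part i)).det := by
  rw [mvCharpoly, RingHom.map_det]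
  congr 1
  ext i j
  by_cases h : i = j <;> simp [h]

/-- The reason for negative nodes: subtracting `x` adds a positive diagonal to a positive
semidefinite matrix, so elimination without pivoting is safe. -/
theorem evals_evalCharpolyC {m p : ℕ} {G : Matrix (Fin m) (Fin m) ℝ} (hG : G.PosSemidef)
    (part : Fin m → Fin p) {x : Fin p → ℝ} (hx : ∀ l, x l < 0) :
    Evals (evalCharpolyC G part x) (MvPolynomial.eval x (mvCharpoly G part)) := by
  rw [eval_mvCharpoly]
  refine (evals_tabulate fun i => evals_tabulate fun j => ?_).bind (evals_detC ?_)
  · by_cases h : i = j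
    · subst h
      simpa using evals_subC _ _
    · simpa [h] using evals_pure _
  · rw [sub_eq_add_neg, diagonal_neg]
    exact PosDef.posSemidef_add hG (PosDef.diagonal fun i => neg_pos.mpr (hx _))

end Elimination

/-! ## Interpolation -/

section Interpolation

open Polynomial

/-- The interpolation nodes `-1, …, -(d + 1)`. -/
def node (d : ℕ) (t : Fin (d + 1)) : ℝ := ((-((t : ℕ) + 1 : ℤ) : ℤ) : ℝ)

theorem node_injective (d : ℕ) : Function.Injective (node d) := fun s t h => by
  have : (-((s : ℕ) + 1 : ℤ) : ℤ) = -((t : ℕ) + 1 : ℤ) := Int.cast_injective h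
  exact Fin.ext (by omega)

theorem node_neg (d : ℕ) (t : Fin (d + 1)) : node d t < 0 := by
  unfold node
  exact_mod_cast (by omega : (-((t : ℕ) + 1 : ℤ) : ℤ) < 0)

/-- Lagrange interpolation reproduces `X ^ s`; compare the coefficients at `e`. The case `e > d` is
included. -/
theorem sum_coeff_basis_mul_pow {d s : ℕ} (hs : s ≤ d) (e : ℕ) :
    ∑ t, (Lagrange.basis Finset.univ (node d) t).coeff e * node d t ^ s =
      if s = e then 1 else 0 := by
  have h := Lagrange.eq_interpolate (s := Finset.univ) (v := node d) (f := (X : ℝ[X]) ^ s)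
    (node_injective d).injOn (by
      rw [degree_X_pow]
      exact_mod_cast (by simpa using hs : s < (Finset.univ : Finset (Fin (d + 1))).card))
  have h' := congrArg (fun q => coeff q e) h
  simp only [coeff_X_pow, Lagrange.interpolate_apply, finsetSum_coeff, coeff_C_mul, eval_pow,
    eval_X] at h'
  simp only [eq_comm (a := s) (b := e)]
  rw [h']
  exact Finset.sum_congr rfl fun t _ => mul_comm _ _

/-- The effect on the vector of coefficients `c` of a multiplication by the divisor of the `t`-th
Lagrange polynomial that vanishes at the node `s`. -/
noncomputable def divisorStep {d : ℕ} (t : Fin (d + 1)) (c : Fin (d + 1) → ℝ) (s : Fin (d + 1)) :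
    Fin (d + 1) → ℝ :=
  if s = t then c else fun j =>
    (Fin.cases 0 (fun i : Fin d => c i.castSucc) j - node d s * c j) / (node d t - node d s)

/-- Truncating to the coefficients of degree at most `d` is harmless: multiplication by a polynomial
never lets higher coefficients influence lower ones. -/
theorem foldl_divisorStep {d : ℕ} (t : Fin (d + 1)) (l : List (Fin (d + 1))) (q : ℝ[X]) :
    l.foldl (divisorStep t) (fun j => q.coeff j) =
    fun j : Fin (d + 1) => ((l.map fun s =>
      if s = t then 1 else Lagrange.basisDivisor (node d t) (node d s)).prod * q).coeff j := by
  induction l generalizing q with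
  | nil => simp
  | cons s l ih =>
    rw [List.foldl_cons, List.map_cons, List.prod_cons]
    by_cases hs : s = t
    · simpa [divisorStep, hs] using ih q
    · rw [divisorStep, if_neg hs, if_neg hs, mul_comm (Lagrange.basisDivisor _ _), mul_assoc, ← ih]
      congr 1
      funext j
      rw [Lagrange.basisDivisor, mul_assoc, coeff_C_mul, sub_mul, coeff_sub, coeff_C_mul,
        div_eq_inv_mul]
      cases j using Fin.cases <;> simp [coeff_X_mul]

theorem evals_interpolationRule (d e : ℕ) :
    Evals (interpolationRule d e) (List.ofFn fun t =>
      (node d t, (Lagrange.basis Finset.univ (node d) t).coeff e)) := by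
  refine (evals_tabulate (v := node d) fun t => evals_loadInt _).bind
    ((evals_tabulate fun t => ?_).bind (evals_pure _))
  have hprod : ((List.finRange (d + 1)).map fun s =>
      if s = t then 1 else Lagrange.basisDivisor (node d t) (node d s)).prod * 1 =
        Lagrange.basis Finset.univ (node d) t := by
    rw [mul_one, ← Fin.prod_univ_def, Lagrange.basis,
      ← Finset.mul_prod_erase _ _ (Finset.mem_univ t), if_pos rfl, one_mul]
    exact Finset.prod_congr rfl fun s hs => if_neg (Finset.ne_of_mem_erase hs)
  refine (evals_loadInt 1).bind ((evals_loadInt 0).bind ((evals_tabulate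
    (v := fun j : Fin (d + 1) => (1 : ℝ[X]).coeff j) fun j => (evals_pure _).congr ?_).bind
      ((evals_loop (F := divisorStep t) (fun s _ c => ?_) _).bind ?_)))
  · rw [coeff_one, Int.cast_one, Int.cast_zero]
    by_cases hj : j = 0
    · rw [if_pos hj, if_pos (by rw [hj, Fin.val_zero])]
    · rw [if_neg hj, if_neg fun h : (j : ℕ) = 0 => hj (Fin.ext h)]
  · unfold divisorStep
    by_cases hs : s = t
    · simpa only [hs, if_true] using evals_pure _
    · simp only [hs, if_false]
      refine (evals_subC _ _).bind (evals_tabulate fun j =>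
        (evals_mulC _ _).bind ((evals_subC _ _).bind ((evals_divC _ ?_).congr ?_)))
      · exact sub_ne_zero.mpr fun h => hs (node_injective d h).symm
      · simp
  · rw [foldl_divisorStep, hprod]
    split_ifs with he
    · exact evals_pure _
    -- The case `e > d` does occur: for an item whose part is already full, the required exponent is
    -- `m_j + 1`. A Lagrange polynomial has degree `d`, so its coefficient there is `0`.
    · refine (evals_pure _).congr ?_
      rw [coeff_eq_zero_of_natDegree_lt]
      · simp
      · rw [Lagrange.natDegree_basis (node_injective d).injOn (Finset.mem_univ t)]
        simp only [Finset.card_univ, Fintype.card_fin]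
        omega

/-- The grid sum is linear in `f` and factors on monomials. The coefficients `c` are arbitrary so
that the induction can absorb the power of the first variable; `hf` asks for correctness on the grid
only, as elimination is not guaranteed to succeed elsewhere. -/
theorem evals_gridSum {ι : Type*} {p : ℕ} {rules : Fin p → List (ℝ × ℝ)}
    {f : (Fin p → ℝ) → Comp ℝ ℝ} (I : Finset ι) (c : ι → ℝ) (e : ι → Fin p → ℕ)
    (hf : ∀ x, (∀ l, ∃ xw ∈ rules l, xw.1 = x l) →
      Evals (f x) (∑ a ∈ I, c a * ∏ l, x l ^ e a l)) :
    Evals (gridSum p rules f)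
      (∑ a ∈ I, c a * ∏ l, ((rules l).map fun xw => xw.2 * xw.1 ^ e a l).sum) := by
  induction p generalizing c with
  | zero =>
    change Evals (f Fin.elim0) _
    simpa using hf Fin.elim0 fun l => l.elim0
  | succ p ih =>
    refine (evals_sumC (F := fun xw => xw.2 * ∑ a ∈ I, c a * xw.1 ^ e a 0 *
        ∏ l : Fin p, ((rules l.succ).map fun xw => xw.2 * xw.1 ^ e a l.succ).sum)
      fun xw hxw => ?_).congr ?_
    · refine (ih (fun a => c a * xw.1 ^ e a 0) (fun a l => e a l.succ) fun x hx => ?_).bind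
        (evals_mulC _ _)
      refine (hf (Fin.cons xw.1 x) (Fin.cases ⟨xw, hxw, rfl⟩ hx)).congr
        (Finset.sum_congr rfl fun a _ => ?_)
      rw [Fin.prod_univ_succ]
      simp [mul_assoc]
    · have hL : ∀ (L : List (ℝ × ℝ)) (Q : ι → ℝ),
          (L.map fun xw => xw.2 * ∑ a ∈ I, c a * xw.1 ^ e a 0 * Q a).sum =
            ∑ a ∈ I, c a * ((L.map fun xw => xw.2 * xw.1 ^ e a 0).sum * Q a) := by
        intro L Q
        induction L with
        | nil => simp
        | cons xw L ihL =>
          simp only [List.map_cons, List.sum_cons]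
          rw [ihL, Finset.mul_sum, ← Finset.sum_add_distrib]
          exact Finset.sum_congr rfl fun a _ => by ring
      simp only [Fin.prod_univ_succ]
      exact hL _ _

/-- On each monomial of the support the one-variable sums are Kronecker deltas, so exactly the
exponent `e` survives. -/
theorem evals_coeffC {m p : ℕ} {G : Matrix (Fin m) (Fin m) ℝ} (hG : G.PosSemidef)
    (part : Fin m → Fin p) (e : Fin p → ℕ) :
    Evals (coeffC G part (partSize part) e) (charCoeff G part e) := by
  refine (evals_tabulate fun l => evals_interpolationRule _ _).bind
    ((evals_gridSum (mvCharpoly G part).support (fun a => (mvCharpoly G part).coeff a)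
      (fun a => a) fun x hx => ?_).congr ?_)
  · refine (evals_evalCharpolyC hG part fun l => ?_).congr (MvPolynomial.eval_eq' _ _)
    obtain ⟨xw, hxw, h⟩ := hx l
    obtain ⟨t, rfl⟩ := List.mem_ofFn.mp hxw
    rw [← h]
    exact node_neg _ _
  · have h : ∀ a ∈ (mvCharpoly G part).support, (mvCharpoly G part).coeff a *
        ∏ l, ((List.ofFn fun t => (node (partSize part l) t,
          (Lagrange.basis Finset.univ (node (partSize part l)) t).coeff (e l))).map
            fun xw => xw.2 * xw.1 ^ a l).sum =
        if a = Finsupp.equivFunOnFinite.symm e then (mvCharpoly G part).coeff a else 0 := by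
      intro a ha
      simp only [List.map_ofFn, List.sum_ofFn, Function.comp_def]
      rw [Finset.prod_congr rfl fun l _ => sum_coeff_basis_mul_pow
        (le_partSize_of_mem_support part G ha l) (e l), Finset.prod_ite_zero]
      simp [DFunLike.ext_iff]
    rw [Finset.sum_congr rfl h, Finset.sum_ite_eq', charCoeff]
    split_ifs with h
    · rfl
    · exact (MvPolynomial.notMem_support_iff.mp h).symm

end Interpolation

/-! ## The weights -/

section Weights

variable {m n p : ℕ}

theorem evals_projectC (B : Matrix (Fin m) (Fin n) ℝ) {i : Fin m} (h : B i ⬝ᵥ B i ≠ 0) :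
    Evals (projectC B i (B i ⬝ᵥ B i)) (projectRows B i) :=
  evals_tabulate fun _ => (evals_dotC _ _).bind ((evals_divC _ h).bind
    (evals_tabulate fun _ => (evals_mulC _ _).bind (evals_subC _ _)))

theorem posSemidef_gram (B : Matrix (Fin m) (Fin n) ℝ) : (B * Bᵀ).PosSemidef := by
  simpa [conjTranspose_eq_transpose_of_trivial] using posSemidef_self_mul_conjTranspose B

theorem evals_weightC (part : Fin m → Fin p) (k t : Fin p → ℕ) (B : Matrix (Fin m) (Fin n) ℝ)
    (i : Fin m) :
    Evals (weightC part (partSize part) k t B i) ((B i ⬝ᵥ B i) *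
      |charCoeff (projectRows B i * (projectRows B i)ᵀ) part
        (coeffIndex part (partSize part) k t i)|) := by
  refine (evals_dotC _ _).bind ((evals_isPos _).bind ?_)
  by_cases h : 0 < B i ⬝ᵥ B i
  · simp only [h, decide_true, if_true]
    exact (evals_projectC B h.ne').bind ((evals_gramC _).bind ((evals_tabulate fun l =>
      evals_pure _).bind ((evals_coeffC (posSemidef_gram _) part _).bind
        ((evals_absC _).bind (evals_mulC _ _)))))
  -- A sum of squares that is not positive is zero, so skipping the division agrees with the
  -- formula.
  · have h0 : B i ⬝ᵥ B i = 0 :=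
      le_antisymm (not_lt.mp h) (Finset.sum_nonneg fun s _ => mul_self_nonneg _)
    simp only [h0, lt_irrefl, decide_false, Bool.false_eq_true, if_false, zero_mul]
    exact (evals_loadInt 0).congr (by simp)

theorem itemWeight_eq (A : Matrix (Fin m) (Fin n) ℝ) (part : Fin m → Fin p) (k : Fin p → ℕ)
    (S : Finset (Fin m)) (i : Fin m) :
    itemWeight A part k S i = (residual A S i ⬝ᵥ residual A S i) *
      |charCoeff (projectRows (residual A S) i * (projectRows (residual A S) i)ᵀ) part
        (coeffIndex part (partSize part) k (partCount part S) i)| := by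
  rw [itemWeight, residual_insert, EuclideanSpace.norm_sq_eq, dotProduct]
  simp [sq]

theorem evals_weightC_residual (A : Matrix (Fin m) (Fin n) ℝ) (part : Fin m → Fin p)
    (k : Fin p → ℕ) (S : Finset (Fin m)) (i : Fin m) :
    Evals (weightC part (partSize part) k (partCount part S) (residual A S) i)
      (itemWeight A part k S i) :=
  (evals_weightC _ _ _ _ _).congr (itemWeight_eq _ _ _ _ _).symm

end Weights

end PartitionDPP

namespace PartitionDPP

open Matrix

/-! ## The mass of the extensions of a set -/

section Extensions

variable {m n p : ℕ} (A : Matrix (Fin m) (Fin n) ℝ) (part : Fin m → Fin p) (k : Fin p → ℕ)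

/-- The total unnormalized mass of the sets `U ⊇ S` that satisfy the partition constraint. -/
noncomputable def extWeight (S : Finset (Fin m)) : ℝ :=
  ∑ U : Finset (Fin m), if S ⊆ U ∧ partCount part U = k then gramDet A U else 0

variable {A part k}

theorem mem_constraintSet {U : Finset (Fin m)} :
    U ∈ constraintSet part k ↔ partCount part U = k :=
  funext_iff.symm

theorem card_eq_of_partCount_eq {U : Finset (Fin m)} (h : partCount part U = k) :
    U.card = ∑ l, k l := by
  rw [← h, sum_partCount]

variable (A part k)

theorem extWeight_nonneg (S : Finset (Fin m)) : 0 ≤ extWeight A part k S :=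
  Finset.sum_nonneg fun U _ => by
    split_ifs
    exacts [gramDet_nonneg A U, le_rfl]

theorem gramDet_le_extWeight {S U : Finset (Fin m)} (hS : S ⊆ U) (hU : partCount part U = k) :
    gramDet A U ≤ extWeight A part k S := by
  rw [extWeight, ← Finset.sum_filter]
  exact Finset.single_le_sum (fun V _ => gramDet_nonneg A V) (by simp [hS, hU])

theorem extWeight_of_card {S : Finset (Fin m)} (hS : S.card = ∑ l, k l) :
    extWeight A part k S = if partCount part S = k then gramDet A S else 0 := by
  rw [extWeight, Finset.sum_eq_single S]
  · simp
  · rintro U - hU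
    rw [if_neg]
    rintro ⟨h1, h2⟩
    exact hU (Finset.eq_of_subset_of_card_le h1
      (by rw [card_eq_of_partCount_eq h2, hS])).symm
  · simp

/-- Double count: an admissible `U ⊇ S` is counted once for each of the `k - |S|` elements of `U \
S`. -/
theorem sum_extWeight_insert (S : Finset (Fin m)) :
    ∑ i, (if i ∈ S then 0 else extWeight A part k (insert i S)) =
      (((∑ l, k l : ℕ) : ℝ) - S.card) * extWeight A part k S := by
  have h1 : ∀ i, (if i ∈ S then 0 else extWeight A part k (insert i S)) =
      ∑ U : Finset (Fin m), if i ∈ U \ S then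
        (if S ⊆ U ∧ partCount part U = k then gramDet A U else 0) else 0 := by
    intro i
    by_cases hi : i ∈ S
    · simp [hi]
    · rw [if_neg hi, extWeight]
      refine Finset.sum_congr rfl fun U _ => ?_
      by_cases hU : i ∈ U <;> simp [hi, hU, Finset.insert_subset_iff]
  rw [Finset.sum_congr rfl fun i _ => h1 i, Finset.sum_comm, extWeight, Finset.mul_sum]
  refine Finset.sum_congr rfl fun U _ => ?_
  rw [Finset.sum_ite_mem, Finset.univ_inter, Finset.sum_const, nsmul_eq_mul]
  split_ifs with h
  · rw [Finset.card_sdiff_of_subset h.1, Nat.cast_sub (Finset.card_le_card h.1),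
      card_eq_of_partCount_eq h.2]
  · simp

variable {k} in
-- Substitute `U = S ∪ T` and factor with `gramDet_union`. The condition on `Tᶜ` says that `T` has
-- `k_l - t_l` elements in part `l`; `hk` keeps the truncated subtraction honest.
theorem extWeight_eq (hk : ∀ l, k l ≤ partSize part l) (S : Finset (Fin m)) :
    extWeight A part k S = gramDet A S * |charCoeff (residual A S * (residual A S)ᵀ) part
      (fun l => partSize part l - k l + partCount part S l)| := by
  have hcond : ∀ T : Finset (Fin m),
      (partCount part Tᶜ = fun l => partSize part l - k l + partCount part S l) ↔
        ∀ l, partCount part S l + partCount part T l = k l := fun T => by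
    rw [funext_iff]
    refine forall_congr' fun l => ?_
    have := partCount_add_compl part T l
    have := hk l
    omega
  rw [abs_charCoeff_gram, Finset.mul_sum, extWeight]
  have hR : ∀ T : Finset (Fin m), gramDet A S * (if partCount part Tᶜ = fun l =>
      partSize part l - k l + partCount part S l then gramDet (residual A S) T else 0) =
      if Disjoint S T ∧ partCount part (S ∪ T) = k then gramDet A (S ∪ T) else 0 := by
    intro T
    by_cases hd : Disjoint S T
    · have h : partCount part (S ∪ T) = k ↔
          partCount part Tᶜ = fun l => partSize part l - k l + partCount part S l := by
        rw [hcond, funext_iff]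
        simp only [partCount_union part hd]
      simp only [hd, true_and, h]
      split_ifs
      · exact (gramDet_union A S T hd).symm
      · exact mul_zero _
    -- The coefficient also sums over sets `T` that meet `S`; these contribute nothing, because the
    -- residual rows of `S` are zero.
    · obtain ⟨i, hi, hi'⟩ := Finset.not_disjoint_iff.mp hd
      simp [hd, gramDet_eq_zero hi' (residual_apply_mem A hi)]
  rw [Finset.sum_congr rfl fun T _ => hR T, ← Finset.sum_filter, ← Finset.sum_filter]
  refine Finset.sum_bij' (fun U _ => U \ S) (fun T _ => S ∪ T) ?_ ?_ ?_ ?_ ?_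
  · intro U hU
    obtain ⟨h1, h2⟩ := (Finset.mem_filter.mp hU).2
    simp only [Finset.mem_filter, Finset.mem_univ, true_and, Finset.union_sdiff_of_subset h1]
    exact ⟨Finset.disjoint_sdiff, h2⟩
  · intro T hT
    obtain ⟨h1, h2⟩ := (Finset.mem_filter.mp hT).2
    simp only [Finset.mem_filter, Finset.mem_univ, true_and]
    exact ⟨Finset.subset_union_left, h2⟩
  · intro U hU
    exact Finset.union_sdiff_of_subset (Finset.mem_filter.mp hU).2.1
  · intro T hT
    exact Finset.union_sdiff_cancel_left (Finset.mem_filter.mp hT).2.1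
  · intro U hU
    rw [Finset.union_sdiff_of_subset (Finset.mem_filter.mp hU).2.1]

variable {A part k}

theorem gramDet_pos_of_extWeight_pos (hk : ∀ l, k l ≤ partSize part l) {S : Finset (Fin m)}
    (h : 0 < extWeight A part k S) : 0 < gramDet A S := by
  refine (gramDet_nonneg A S).lt_of_ne fun h0 => ?_
  rw [extWeight_eq A part hk, ← h0, zero_mul] at h
  exact lt_irrefl _ h

theorem itemWeight_nonneg (S : Finset (Fin m)) (i : Fin m) : 0 ≤ itemWeight A part k S i :=
  mul_nonneg (sq_nonneg _) (abs_nonneg _)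

/-- The factor `‖b_i‖²` extends `gramDet A S` to `S ∪ {i}`, and the `+ 1` in `coeffIndex` is the
change of the part count, so `extWeight_eq` applies to `S ∪ {i}`. Items of `S` have weight zero and
are never repeated. -/
theorem gramDet_mul_itemWeight (hk : ∀ l, k l ≤ partSize part l) (S : Finset (Fin m)) (i : Fin m) :
    gramDet A S * itemWeight A part k S i =
      if i ∈ S then 0 else extWeight A part k (insert i S) := by
  rw [itemWeight_eq]
  split_ifs with hi
  · simp [residual_apply_mem A hi]
  · rw [← mul_assoc, ← gramDet_insert_residual A hi, extWeight_eq A part hk, residual_insert]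
    congr 4
    funext l
    rw [coeffIndex, partCount_insert part hi, add_assoc]

theorem Feasible.extWeight_pos (h : Feasible A part k) : 0 < extWeight A part k ∅ := by
  obtain ⟨S, hS, hS'⟩ := h
  rw [dpp, PMF.mem_support_normalize_iff, ne_eq, ENNReal.ofReal_eq_zero, not_le] at hS'
  exact hS'.trans_le (gramDet_le_extWeight A part k (Finset.empty_subset S)
    (mem_constraintSet.mp hS))

theorem Feasible.le_partSize (h : Feasible A part k) (l : Fin p) : k l ≤ partSize part l := by
  obtain ⟨S, hS, -⟩ := h
  rw [← hS l]
  exact partCount_mono part (Finset.subset_univ S) l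

end Extensions

/-! ## The marginals of the ordered Partition-DPP -/

section Marginals

variable {m n p : ℕ} {A : Matrix (Fin m) (Fin n) ℝ} {part : Fin m → Fin p} {k : Fin p → ℕ}

theorem image_snoc {t : ℕ} (y : Fin t → Fin m) (i : Fin m) :
    Finset.univ.image (Fin.snoc y i : Fin (t + 1) → Fin m) = insert i (Finset.univ.image y) := by
  ext j
  simp only [Finset.mem_image, Finset.mem_univ, true_and, Finset.mem_insert]
  constructor
  · rintro ⟨b, rfl⟩
    cases b using Fin.lastCases with
    | last => simp
    | cast b => simp
  · rintro (rfl | ⟨b, rfl⟩)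
    · exact ⟨Fin.last t, Fin.snoc_last _ _⟩
    · exact ⟨b.castSucc, Fin.snoc_castSucc _ _ _⟩

theorem orderedProb_eq (x : Fin (∑ l, k l) → Fin m) :
    orderedProb A part k x =
      if Function.Injective x ∧ partCount part (Finset.univ.image x) = k then
        gramDet A (Finset.univ.image x) / ((∑ l, k l).factorial * extWeight A part k ∅)
      else 0 := by
  classical
  rw [orderedProb]
  simp only [mem_constraintSet, extWeight, Finset.empty_subset, true_and, Finset.sum_filter]

theorem prefixProb_succ {t : ℕ} (ht : t < ∑ l, k l) (y : Fin t → Fin m) :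
    prefixProb A part k y = ∑ i, prefixProb A part k (Fin.snoc y i : Fin (t + 1) → Fin m) := by
  classical
  unfold prefixProb
  rw [← Finset.sum_fiberwise _ fun x => x ⟨t, ht⟩]
  refine Finset.sum_congr rfl fun i _ => Finset.sum_congr ?_ fun _ _ => rfl
  rw [Finset.filter_filter]
  refine Finset.filter_congr fun x _ => ⟨?_, ?_⟩
  · rintro ⟨h1, h2⟩ a b hab
    refine Fin.lastCases (fun hab => ?_) (fun b hab => ?_) b hab
    · rw [Fin.snoc_last, ← h2]
      exact congrArg x (Fin.ext hab)
    · rw [Fin.snoc_castSucc]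
      exact h1 a b hab
  · intro h
    refine ⟨fun a b hab => ?_, ?_⟩
    · rw [h a b.castSucc hab, Fin.snoc_castSucc]
    · rw [h ⟨t, ht⟩ (Fin.last t) rfl, Fin.snoc_last]

theorem prefixProb_full (x : Fin (∑ l, k l) → Fin m) :
    prefixProb A part k x = orderedProb A part k x := by
  classical
  rw [prefixProb, ← Finset.sum_singleton (orderedProb A part k) x]
  refine Finset.sum_congr (Finset.ext fun z => ?_) fun _ _ => rfl
  simp only [Finset.mem_filter, Finset.mem_univ, true_and, Finset.mem_singleton]
  refine ⟨fun h => funext fun a => h a a rfl, ?_⟩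
  rintro rfl a b hab
  rw [Fin.ext hab]

/-- Induction downwards from full tuples; summing out one entry produces the factor `k - t` by
`sum_extWeight_insert`. -/
theorem prefixProb_eq {t : ℕ} (ht : t ≤ ∑ l, k l) (y : Fin t → Fin m) :
    prefixProb A part k y = if Function.Injective y then
      (∑ l, k l - t).factorial / ((∑ l, k l).factorial * extWeight A part k ∅) *
        extWeight A part k (Finset.univ.image y) else 0 := by
  induction ht using Nat.decreasingInduction with
  | self =>
    rw [prefixProb_full, orderedProb_eq]
    by_cases hy : Function.Injective y
    · rw [extWeight_of_card A part k (S := Finset.univ.image y) (by rw [Finset.card_image_of_injective _ hy, Finset.card_fin])]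
      simp only [hy, true_and, if_true, Nat.sub_self, Nat.factorial_zero, Nat.cast_one]
      split_ifs
      · ring
      · ring
    · simp [hy]
  | of_succ t ht ih =>
    rw [prefixProb_succ ht]
    simp only [ih, Fin.snoc_injective_iff, image_snoc]
    by_cases hy : Function.Injective y
    · have h1 : ∀ i, (if Function.Injective y ∧ i ∉ Set.range y then
          ((∑ l, k l - (t + 1)).factorial : ℝ) / ((∑ l, k l).factorial * extWeight A part k ∅) *
            extWeight A part k (insert i (Finset.univ.image y)) else 0) =
          ((∑ l, k l - (t + 1)).factorial : ℝ) / ((∑ l, k l).factorial * extWeight A part k ∅) *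
            (if i ∈ Finset.univ.image y then 0 else
              extWeight A part k (insert i (Finset.univ.image y))) := fun i => by
        have : i ∈ Finset.univ.image y ↔ i ∈ Set.range y := by simp
        by_cases hi : i ∈ Set.range y
        · rw [if_neg fun h => h.2 hi, if_pos (this.mpr hi), mul_zero]
        · rw [if_pos ⟨hy, hi⟩, if_neg (mt this.mp hi)]
      rw [Finset.sum_congr rfl fun i _ => h1 i, ← Finset.mul_sum, sum_extWeight_insert, if_pos hy,
        Finset.card_image_of_injective _ hy, Finset.card_fin]
      have h2 : ∑ l, k l - t = (∑ l, k l - (t + 1)) + 1 := by omega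
      have h3 : ((∑ l, k l : ℕ) : ℝ) - t = ((∑ l, k l - (t + 1) : ℕ) : ℝ) + 1 := by
        rw [Nat.cast_sub ht]
        push_cast
        ring
      rw [h3, h2, Nat.factorial_succ, Nat.cast_mul, Nat.cast_succ]
      ring
    · simp [hy]

/-- The quotient of the factorials is `1 / (k - t)`, and `gramDet A S` cancels between `W(S ∪ {i})`
and `W(S)`. -/
theorem prefixProb_snoc_div {t : ℕ} (ht : t < ∑ l, k l) (hk : ∀ l, k l ≤ partSize part l)
    (y : Fin t → Fin m) (hy : 0 < prefixProb A part k y) (i : Fin m) :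
    prefixProb A part k (Fin.snoc y i : Fin (t + 1) → Fin m) / prefixProb A part k y =
      itemWeight A part k (Finset.univ.image y) i / ((((∑ l, k l : ℕ) : ℝ) - t) *
        |charCoeff (residual A (Finset.univ.image y) * (residual A (Finset.univ.image y))ᵀ) part
          (fun l => partSize part l - k l + partCount part (Finset.univ.image y) l)|) := by
  classical
  have hinj : Function.Injective y := by
    by_contra h
    simp [prefixProb_eq ht.le, h] at hy
  rw [prefixProb_eq ht.le, if_pos hinj] at hy
  rw [prefixProb_eq ht.le, if_pos hinj, prefixProb_eq ht]
  simp only [Fin.snoc_injective_iff, image_snoc]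
  set S := Finset.univ.image y with hS
  have hW : 0 < extWeight A part k S := by
    refine (extWeight_nonneg A part k S).lt_of_ne fun h => ?_
    rw [← h, mul_zero] at hy
    exact lt_irrefl _ hy
  have hZ : extWeight A part k ∅ ≠ 0 := fun h => by
    rw [h, mul_zero, div_zero, zero_mul] at hy
    exact lt_irrefl _ hy
  have hg := (gramDet_pos_of_extWeight_pos hk hW).ne'
  have hw := gramDet_mul_itemWeight (A := A) hk S i
  have hc := extWeight_eq A part hk S
  set c := |charCoeff (residual A S * (residual A S)ᵀ) part
    (fun l => partSize part l - k l + partCount part S l)|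
  have hc0 : c ≠ 0 := fun h => by
    rw [h, mul_zero] at hc
    exact hW.ne' hc
  have hmem : i ∈ S ↔ i ∈ Set.range y := by simp [hS]
  by_cases hi : i ∈ S
  · rw [if_pos hi] at hw
    rw [if_neg fun h => h.2 (hmem.mp hi), (mul_eq_zero.mp hw).resolve_left hg]
    simp
  · rw [if_neg hi] at hw
    have h2 : ∑ l, k l - t = (∑ l, k l - (t + 1)) + 1 := by omega
    have h3 : ((∑ l, k l : ℕ) : ℝ) - t = ((∑ l, k l - (t + 1) : ℕ) : ℝ) + 1 := by
      rw [Nat.cast_sub ht]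
      push_cast
      ring
    rw [if_pos ⟨hinj, fun h => hi (hmem.mpr h)⟩, ← hw, hc, h3, h2, Nat.factorial_succ,
      Nat.cast_mul, Nat.cast_succ]
    have : ((∑ l, k l - (t + 1)).factorial : ℝ) ≠ 0 := by positivity
    have : ((∑ l, k l).factorial : ℝ) ≠ 0 := by positivity
    have : ((∑ l, k l - (t + 1) : ℕ) : ℝ) + 1 ≠ 0 := by positivity
    field_simp

end Marginals

end PartitionDPP

namespace PartitionDPP

open Matrix PartitionDPP.Comp

/-! ## The law of the sampler -/

section PMFLemmas

/-- The total mass is one, so the crash probability is determined by the others and needs no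
separate treatment. -/
theorem PMF_option_ext {α : Type*} [Fintype α] {p q : PMF (Option α)}
    (h : ∀ a, p (some a) = q (some a)) : p = q := by
  have hp := p.tsum_coe
  have hq := q.tsum_coe
  rw [tsum_fintype, Fintype.sum_option] at hp hq
  have hne : ∑ a, q (some a) ≠ ⊤ := fun hT => by simp [hT] at hq
  refine PMF.ext fun o => ?_
  cases o with
  | none =>
    rw [Finset.sum_congr rfl fun a _ => h a, ← hq] at hp
    exact (ENNReal.add_left_inj hne).mp hp
  | some a => exact h a

theorem normalize_ofReal_apply {α : Type*} [Fintype α] {w : α → ℝ} (hw : ∀ i, 0 ≤ w i)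
    (hs : 0 < ∑ i, w i) (h0 : ∑' i, ENNReal.ofReal (w i) ≠ 0)
    (hT : ∑' i, ENNReal.ofReal (w i) ≠ ⊤) (i : α) :
    PMF.normalize (fun i => ENNReal.ofReal (w i)) h0 hT i =
      ENNReal.ofReal (w i / ∑ j, w j) := by
  rw [PMF.normalize_apply, tsum_fintype, ← ENNReal.ofReal_sum_of_nonneg fun i _ => hw i,
    ENNReal.ofReal_div_of_pos hs, div_eq_mul_inv]

theorem map_cons_apply {α : Type*} [DecidableEq α] (q : PMF (Option (List α))) (i j : α)
    (l : List α) :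
    q.map (Option.map (i :: ·)) (some (j :: l)) = if i = j then q (some l) else 0 := by
  classical
  rw [PMF.map_apply, tsum_eq_single (some l)]
  · simp [eq_comm]
  · rintro (_ | l') h
    · simp
    · rw [if_neg]
      intro h'
      simp only [Option.map_some, Option.some.injEq, List.cons.injEq] at h'
      exact h (by rw [h'.2])

theorem bind_pure_run {α β : Type} (c : Comp ℝ α) (f : α → β) :
    (c >>= fun a => pure (f a)).run = c.run.map (Option.map f) := by
  change (c.andThen fun a => Comp.ret (f a)).run = _
  rw [run_andThen, ← PMF.bind_pure_comp]
  congr 1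
  funext o
  cases o <;> rfl

end PMFLemmas

section Law

variable {m n p : ℕ} {A : Matrix (Fin m) (Fin n) ℝ} {part : Fin m → Fin p} {k : Fin p → ℕ}

/-- The law of the items that are picked in `r` rounds after the items of `S` have been picked. -/
noncomputable def pickLaw (A : Matrix (Fin m) (Fin n) ℝ) (part : Fin m → Fin p) (k : Fin p → ℕ)
    (r : ℕ) (S : Finset (Fin m)) : PMF (Option (List (Fin m))) :=
  (pickC part (partSize part) k r (partCount part S) (residual A S)).run

theorem pickLaw_succ (hk : ∀ l, k l ≤ partSize part l) {r : ℕ} {S : Finset (Fin m)}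
    (hr : S.card + (r + 1) = ∑ l, k l) (hS : 0 < extWeight A part k S) :
    ∃ q : PMF (Fin m),
      (∀ i, q i = ENNReal.ofReal ((if i ∈ S then 0 else extWeight A part k (insert i S)) /
        ((r + 1) * extWeight A part k S))) ∧
      pickLaw A part k (r + 1) S =
        q.bind fun i => (pickLaw A part k r (insert i S)).map (Option.map (i :: ·)) := by
  have hg := gramDet_pos_of_extWeight_pos hk hS
  have hw : ∀ i, itemWeight A part k S i =
      (if i ∈ S then 0 else extWeight A part k (insert i S)) / gramDet A S := fun i => by
    rw [← gramDet_mul_itemWeight hk, mul_div_cancel_left₀ _ hg.ne']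
  have hsum : ∑ i, itemWeight A part k S i = (r + 1) * extWeight A part k S / gramDet A S := by
    rw [Finset.sum_congr rfl fun i _ => hw i, ← Finset.sum_div, sum_extWeight_insert, ← hr]
    push_cast
    ring
  have hpos : 0 < ∑ i, itemWeight A part k S i := by
    rw [hsum]
    positivity
  have hvalid : (∀ i, 0 ≤ itemWeight A part k S i) ∧ 0 < ∑ i, itemWeight A part k S i :=
    ⟨itemWeight_nonneg S, hpos⟩
  refine ⟨PMF.normalize (fun i => ENNReal.ofReal (itemWeight A part k S i)) ?_ ?_,
    fun i => ?_, ?_⟩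
  · rw [tsum_fintype, ← ENNReal.ofReal_sum_of_nonneg fun i _ => hvalid.1 i]
    exact (ENNReal.ofReal_pos.mpr hpos).ne'
  · rw [tsum_fintype]
    exact ENNReal.sum_ne_top.mpr fun _ _ => ENNReal.ofReal_ne_top
  · rw [normalize_ofReal_apply hvalid.1 hpos, hsum, hw, div_div_div_cancel_right₀ hg.ne']
  · rw [pickLaw, pickC]
    simp only [run]
    rw [(evals_tabulate fun i => evals_weightC_residual A part k S i).run_bind]
    change (Comp.draw m (itemWeight A part k S) fun i => _).run = _
    simp only [run]
    rw [dif_pos hvalid]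
    refine PMF.ext fun o => ?_
    rw [PMF.bind_apply, PMF.bind_apply]
    refine tsum_congr fun i => ?_
    -- After an item of weight zero the program could divide by zero, but such a branch has
    -- probability zero.
    by_cases hi : itemWeight A part k S i = 0
    · rw [PMF.normalize_apply, hi]
      simp
    congr 1
    have hiS : i ∉ S := fun h => hi (by rw [hw, if_pos h, zero_div])
    have hq : residual A S i ⬝ᵥ residual A S i ≠ 0 := fun h => hi (by
      rw [itemWeight_eq, h, zero_mul])
    change ((dotC (residual A S i) (residual A S i)) >>= _).run o = _
    rw [(evals_dotC _ _).run_bind, (evals_projectC _ hq).run_bind,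
      (evals_tabulate fun l => evals_pure _).run_bind, bind_pure_run, pickLaw, residual_insert]
    congr 4
    funext l
    rw [partCount_insert part hiS]

theorem pickLaw_apply_list (hk : ∀ l, k l ≤ partSize part l) (r : ℕ) (S : Finset (Fin m))
    (hr : S.card + r = ∑ l, k l) (hS : 0 < extWeight A part k S) (x : List (Fin m)) :
    pickLaw A part k r S (some x) = ENNReal.ofReal (
      if x.length = r ∧ x.Nodup ∧ Disjoint S x.toFinset ∧ partCount part (S ∪ x.toFinset) = k then
        gramDet A (S ∪ x.toFinset) / (r.factorial * extWeight A part k S) else 0) := by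
  classical
  induction r generalizing S x with
  | zero =>
    rw [add_zero] at hr
    have hW := extWeight_of_card A part k hr
    have hc : partCount part S = k := by
      by_contra h
      rw [if_neg h] at hW
      exact hS.ne' hW
    rw [if_pos hc] at hW
    change PMF.pure (some []) (some x) = _
    rw [PMF.pure_apply]
    cases x with
    | nil =>
      rw [hW] at hS ⊢
      simp [hc, hS.ne']
    | cons i x => simp
  | succ r ih =>
    obtain ⟨q, hq, hlaw⟩ := pickLaw_succ hk hr hS
    rw [hlaw, PMF.bind_apply, tsum_fintype]
    cases x with
    | nil => simp
    | cons j x =>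
      simp only [map_cons_apply]
      rw [Finset.sum_eq_single j (fun i _ hij => by rw [if_neg hij, mul_zero]) (by simp),
        if_pos rfl, hq]
      by_cases hj : j ∈ S
      · rw [if_pos hj, if_neg]
        · simp
        · rintro ⟨-, -, hd, -⟩
          exact Finset.disjoint_left.mp hd hj (by simp)
      rw [if_neg hj]
      have hU : S ∪ (j :: x).toFinset = insert j S ∪ x.toFinset := by
        rw [List.toFinset_cons, Finset.union_insert, Finset.insert_union]
      -- If `W(S ∪ {j}) = 0`, the induction hypothesis is unavailable; the draw then has probability
      -- zero, and the target determinant, bounded by this mass, vanishes too.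
      rcases (extWeight_nonneg A part k (insert j S)).eq_or_lt with h0 | h0
      · rw [← h0, zero_div, ENNReal.ofReal_zero, zero_mul, hU]
        split_ifs with h
        · have := gramDet_le_extWeight A part k (Finset.subset_union_left
            (s₁ := insert j S) (s₂ := x.toFinset)) h.2.2.2
          rw [← h0] at this
          rw [le_antisymm this (gramDet_nonneg _ _), zero_div, ENNReal.ofReal_zero]
        · simp
      · rw [ih (insert j S) (by rw [Finset.card_insert_of_notMem hj]; omega) h0,
          ← ENNReal.ofReal_mul (by positivity), hU]
        have hcond : (x.length = r ∧ x.Nodup ∧ Disjoint (insert j S) x.toFinset ∧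
            partCount part (insert j S ∪ x.toFinset) = k) ↔
            ((j :: x).length = r + 1 ∧ (j :: x).Nodup ∧ Disjoint S (j :: x).toFinset ∧
              partCount part (insert j S ∪ x.toFinset) = k) := by
          simp only [List.length_cons, Nat.add_right_cancel_iff, List.nodup_cons,
            Finset.disjoint_insert_left, List.mem_toFinset, List.toFinset_cons,
            Finset.disjoint_insert_right]
          tauto
        simp only [hcond]
        split_ifs
        · congr 1
          rw [Nat.factorial_succ, Nat.cast_mul, Nat.cast_succ]
          have : (r.factorial : ℝ) ≠ 0 := by positivity
          have : (r : ℝ) + 1 ≠ 0 := by positivity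
          have := hS.ne'
          have := h0.ne'
          field_simp
        · rw [mul_zero]

/-- A direct induction instead of a sum over orderings: each of the `r + 1` elements of `U \ S` is
equally likely to come first within `U`. -/
theorem pickLaw_map_toFinset (hk : ∀ l, k l ≤ partSize part l) (r : ℕ) (S : Finset (Fin m))
    (hr : S.card + r = ∑ l, k l) (hS : 0 < extWeight A part k S) (U : Finset (Fin m)) :
    (pickLaw A part k r S).map (Option.map fun x => S ∪ x.toFinset) (some U) = ENNReal.ofReal (
      if S ⊆ U ∧ partCount part U = k then gramDet A U / extWeight A part k S else 0) := by
  classical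
  induction r generalizing S with
  | zero =>
    rw [add_zero] at hr
    have hW := extWeight_of_card A part k hr
    have hc : partCount part S = k := by
      by_contra h
      rw [if_neg h] at hW
      exact hS.ne' hW
    rw [if_pos hc] at hW
    change (PMF.pure (some [])).map _ (some U) = _
    rw [PMF.pure_map, PMF.pure_apply]
    have hiff : (S ⊆ U ∧ partCount part U = k) ↔ U = S := by
      constructor
      · rintro ⟨h1, h2⟩
        exact (Finset.eq_of_subset_of_card_le h1 (by rw [card_eq_of_partCount_eq h2, hr])).symm
      · rintro rfl
        exact ⟨subset_rfl, hc⟩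
    by_cases hUS : U = S
    · rw [if_pos (hiff.mpr hUS), hUS, hW, div_self (hW ▸ hS).ne']
      simp
    · rw [if_neg (mt hiff.mp hUS), if_neg (by simpa using hUS), ENNReal.ofReal_zero]
  | succ r ih =>
    obtain ⟨q, hq, hlaw⟩ := pickLaw_succ hk hr hS
    have hcomp : ∀ i, (fun x : List (Fin m) => S ∪ x.toFinset) ∘ (i :: ·) =
        fun x => insert i S ∪ x.toFinset := fun i => by
      funext x
      simp [Finset.union_insert, Finset.insert_union]
    rw [hlaw, PMF.map_bind, PMF.bind_apply, tsum_fintype]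
    have hterm : ∀ i, q i * (((pickLaw A part k r (insert i S)).map (Option.map (i :: ·))).map
        (Option.map fun x => S ∪ x.toFinset)) (some U) = ENNReal.ofReal (
          if i ∈ U \ S then (if S ⊆ U ∧ partCount part U = k then
            gramDet A U / ((r + 1) * extWeight A part k S) else 0) else 0) := by
      intro i
      rw [PMF.map_comp, Option.map_comp_map, hcomp, hq]
      by_cases hi : i ∈ S
      · simp [hi]
      rw [if_neg hi]
      have hcond : (i ∈ U \ S ∧ S ⊆ U ∧ partCount part U = k) ↔
          (insert i S ⊆ U ∧ partCount part U = k) := by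
        simp only [Finset.mem_sdiff, hi, Finset.insert_subset_iff]
        tauto
      rw [← ite_and]
      simp only [hcond]
      rcases (extWeight_nonneg A part k (insert i S)).eq_or_lt with h0 | h0
      · rw [← h0, zero_div, ENNReal.ofReal_zero, zero_mul]
        split_ifs with h
        · have := gramDet_le_extWeight A part k h.1 h.2
          rw [← h0] at this
          rw [le_antisymm this (gramDet_nonneg _ _), zero_div, ENNReal.ofReal_zero]
        · simp
      · rw [ih (insert i S) (by rw [Finset.card_insert_of_notMem hi]; omega) h0,
          ← ENNReal.ofReal_mul (by positivity)]
        split_ifs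
        · congr 1
          have := h0.ne'
          field_simp
        · rw [mul_zero]
    rw [Finset.sum_congr rfl fun i _ => hterm i, ← ENNReal.ofReal_sum_of_nonneg]
    · rw [Finset.sum_ite_mem, Finset.univ_inter, Finset.sum_const, nsmul_eq_mul]
      split_ifs with h
      · have hcard : (U \ S).card = r + 1 := by
          rw [Finset.card_sdiff_of_subset h.1, card_eq_of_partCount_eq h.2]
          omega
        rw [hcard]
        congr 1
        push_cast
        have : (r : ℝ) + 1 ≠ 0 := by positivity
        field_simp
      · simp
    · intro i _
      have := gramDet_nonneg A U
      split_ifs <;> positivity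

theorem foldl_partSize (part : Fin m → Fin p) (l : Fin p) :
    (List.finRange m).foldl (fun c i => if part i = l then c + 1 else c) 0 = partSize part l := by
  have h : ∀ (L : List (Fin m)) (c : ℕ), L.foldl (fun c i => if part i = l then c + 1 else c) c =
      c + (L.map fun i => if part i = l then 1 else 0).sum := by
    intro L
    induction L with
    | nil => simp
    | cons i L ih =>
      intro c
      rw [List.foldl_cons, ih, List.map_cons, List.sum_cons]
      split_ifs <;> omega
  rw [h, zero_add, ← Fin.sum_univ_def, partSize, Finset.card_filter]

theorem foldl_total (k : Fin p → ℕ) :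
    (List.finRange p).foldl (fun c l => c + k l) 0 = ∑ l, k l := by
  rw [← List.foldl_map (f := k) (g := fun c x => c + x), Fin.sum_univ_def, List.sum_eq_foldl]

theorem partCount_empty (part : Fin m → Fin p) : partCount part ∅ = fun _ => 0 := by
  funext l
  simp [partCount]

theorem run_orderedSampler (A : Matrix (Fin m) (Fin n) ℝ) (part : Fin m → Fin p) (k : Fin p → ℕ) :
    (orderedSampler A part k).run = pickLaw A part k (∑ l, k l) ∅ := by
  rw [orderedSampler, ((evals_tabulate fun l => (evals_loop (F := fun c i =>
      if part i = l then c + 1 else c) (fun i _ c => evals_pure _) 0).congr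
        (foldl_partSize part l)) : Evals _ (partSize part)).run_bind,
    ((evals_loop (F := fun c l => c + k l) (fun i _ c => evals_pure _) 0).congr
      (foldl_total k)).run_bind, (evals_tabulate fun l => evals_pure 0).run_bind, pickLaw,
    partCount_empty, residual_empty]

theorem run_orderedSampler_apply (h : Feasible A part k) (x : Fin (∑ l, k l) → Fin m) :
    (orderedSampler A part k).run (some (List.ofFn x)) =
      ENNReal.ofReal (orderedProb A part k x) := by
  rw [run_orderedSampler, pickLaw_apply_list h.le_partSize _ _ (by simp) h.extWeight_pos,
    orderedProb_eq]
  have himg : ∅ ∪ (List.ofFn x).toFinset = Finset.univ.image x := by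
    ext i
    simp [List.mem_ofFn]
  rw [himg]
  simp only [List.length_ofFn, List.nodup_ofFn, Finset.disjoint_empty_left, true_and]

theorem foldl_insert (L : List (Fin m)) :
    L.foldl (fun S i => insert i S) ∅ = L.toFinset := by
  have h : ∀ (L : List (Fin m)) (S : Finset (Fin m)),
      L.foldl (fun S i => insert i S) S = S ∪ L.toFinset := by
    intro L
    induction L with
    | nil => simp
    | cons i L ih =>
      intro S
      rw [List.foldl_cons, ih, List.toFinset_cons, Finset.union_insert, Finset.insert_union]
  rw [h, Finset.empty_union]

theorem run_sampler_eq_map (A : Matrix (Fin m) (Fin n) ℝ) (part : Fin m → Fin p) (k : Fin p → ℕ) :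
    (sampler A part k).run =
      (pickLaw A part k (∑ l, k l) ∅).map (Option.map fun x => ∅ ∪ x.toFinset) := by
  change ((orderedSampler A part k).andThen _).run = _
  rw [run_andThen, run_orderedSampler, ← PMF.bind_pure_comp]
  congr 1
  funext o
  cases o with
  | none => rfl
  | some x =>
    exact ((evals_loop (F := fun S i => insert i S) (fun i _ S => evals_pure _) ∅).congr
      ((foldl_insert x).trans (Finset.empty_union _).symm))

/-- The normalizing constant of the DPP cancels under conditioning. -/
theorem partitionDPP_apply (h : Feasible A part k) (U : Finset (Fin m)) :
    partitionDPP A part k h U = ENNReal.ofReal (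
      if partCount part U = k then gramDet A U / extWeight A part k ∅ else 0) := by
  classical
  have hpos : 0 < ∑ S, gramDet A S :=
    (by rw [gramDet_empty]; exact one_pos : (0 : ℝ) < gramDet A ∅).trans_le
      (Finset.single_le_sum (fun S _ => gramDet_nonneg A S) (Finset.mem_univ ∅))
  have hind : ∀ S, (constraintSet part k).indicator (dpp A) S = ENNReal.ofReal (
      (if partCount part S = k then gramDet A S else 0) / ∑ S, gramDet A S) := by
    intro S
    rw [Set.indicator_apply, dpp, normalize_ofReal_apply (gramDet_nonneg A) hpos]
    simp only [mem_constraintSet]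
    split_ifs <;> simp
  refine (PMF.filter_apply h U).trans ?_
  simp only [hind]
  rw [tsum_fintype, ← ENNReal.ofReal_sum_of_nonneg, ← Finset.sum_div]
  · have hW : ∑ S, (if partCount part S = k then gramDet A S else 0) = extWeight A part k ∅ := by
      simp [extWeight]
    have hWpos := h.extWeight_pos
    rw [hW, ← div_eq_mul_inv, ← ENNReal.ofReal_div_of_pos (div_pos hWpos hpos),
      div_div_div_cancel_right₀ hpos.ne']
    congr 1
    split_ifs <;> simp
  · intro S _
    have := gramDet_nonneg A S
    split_ifs <;> positivity

theorem run_sampler (h : Feasible A part k) :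
    (sampler A part k).run = (partitionDPP A part k h).map some := by
  refine PMF_option_ext fun U => ?_
  rw [run_sampler_eq_map, pickLaw_map_toFinset h.le_partSize _ _ (by simp) h.extWeight_pos]
  rw [PMF.map_apply]
  refine Eq.trans ?_ (tsum_eq_single U fun V hV => by simp [Ne.symm hV]).symm
  simp [partitionDPP_apply]

end Law

end PartitionDPP

namespace PartitionDPP

open PartitionDPP.Comp

/-! ## The running time of the sampler -/

section RunningTime

variable {m n p : ℕ}

/-- Every monomial in the step counts is dominated by `M ^ 3 * G * n`, with `M = m + p` and `G` the
number of grid points; the cost estimates thereby become linear arithmetic. -/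
theorem mul_le_grid_bound {M G n a b c : ℕ} (hM : 1 ≤ M) (ha : a ≤ M ∨ a ≤ M ^ 2 ∨ a ≤ M ^ 3)
    (hb : b ≤ G) (hc : c ≤ n) : a * b * c ≤ M ^ 3 * G * n := by
  refine Nat.mul_le_mul (Nat.mul_le_mul ?_ hb) hc
  rcases ha with h | h | h
  · exact h.trans (Nat.le_self_pow (by norm_num) M)
  · exact h.trans (Nat.pow_le_pow_right hM (by norm_num))
  · exact h

theorem costs_weightC (part : Fin m → Fin p) (k t : Fin p → ℕ) (B : Matrix (Fin m) (Fin n) ℝ)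
    (i : Fin m) (hn : 1 ≤ n) :
    CostsAtMost (weightC part (partSize part) k t B i) (fun _ => True)
      (54 * ((m + p) ^ 3 * (∏ l, (partSize part l + 1)) * n)) := by
  have hm : 1 ≤ m := i.pos
  set G := ∏ l, (partSize part l + 1) with hG
  have hG1 : 1 ≤ G := Finset.one_le_prod' fun l _ => by omega
  have hcoeff : ∀ M e, CostsAtMost (coeffC M part (partSize part) e) (fun _ => True)
      ((14 * (m + p) ^ 3 + p) + G * (m * (4 * m ^ 2 + 2 * m + 3) + 1 + 4 * p)) := fun M e => by
    refine ((costs_tabulate_sum fun l => costs_interpolationRule (partSize part l) (e l)).mono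
      (fun _ h => h) ?_).bind fun rules hrules =>
        (costs_gridSum p rules _ (fun x => costs_evalCharpolyC M part x)
          fun l => by rw [hrules]; omega).mono (fun _ h => h) (by simp only [hrules]; exact le_rfl)
    have hsum : ∑ l, (partSize part l + 1) = m + p := by
      rw [Finset.sum_add_distrib, sum_partSize]
      simp
    have hle : ∀ l, partSize part l + 1 ≤ m + p := fun l => by
      rw [← hsum]
      exact Finset.single_le_sum (f := fun l => partSize part l + 1) (fun _ _ => Nat.zero_le _)
        (Finset.mem_univ l)
    -- Setting up all the interpolation rules is no more than cubic in `m + p`.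
    have hcube : ∑ l, (partSize part l + 1) ^ 3 ≤ (m + p) ^ 3 := by
      calc ∑ l, (partSize part l + 1) ^ 3
          ≤ ∑ l, (m + p) ^ 2 * (partSize part l + 1) :=
            Finset.sum_le_sum fun l _ => by
              rw [pow_succ]
              exact Nat.mul_le_mul_right _ (Nat.pow_le_pow_left (hle l) 2)
        _ = (m + p) ^ 3 := by rw [← Finset.mul_sum, hsum]; ring
    rw [Finset.sum_add_distrib, ← Finset.mul_sum]
    simp only [Finset.sum_const, Finset.card_univ, Fintype.card_fin, smul_eq_mul, mul_one]
    omega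
  have hneg : 1 ≤ 54 * ((m + p) ^ 3 * G * n) := by
    have : 0 < (m + p) ^ 3 * G * n := by positivity
    omega
  refine ((costs_dotC _ _).bind fun q _ => (costs_isPos q).bind
    (K' := m * (6 * n + 3) + (m * (m * (3 * n + 2) + 1) + (p * 1 +
      ((14 * (m + p) ^ 3 + p) + G * (m * (4 * m ^ 2 + 2 * m + 3) + 1 + 4 * p) + (3 + 1)))))
    fun b _ => ?_).mono (fun _ h => h) ?_
  · cases b
    · exact (costs_loadInt 0).mono (fun _ h => h) (by omega)
    · exact (costs_projectC B i q).bind fun C _ => (costs_gramC C).bind fun M _ =>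
        (costs_tabulate (K := 0) (P := fun _ _ => True) fun l => costs_pure trivial).bind
          fun e _ => (hcoeff M e).bind fun c _ => (costs_absC c).bind fun a _ => costs_mulC _ _
  · have hM : 1 ≤ m + p := by omega
    have hmM : m ≤ m + p := by omega
    have h1 := mul_le_grid_bound (a := 1) hM (.inl hM) hG1 hn
    have h2 := mul_le_grid_bound (a := 1) hM (.inl hM) hG1 (le_refl n)
    have h3 := mul_le_grid_bound hM (.inl hmM) hG1 (le_refl n)
    have h4 := mul_le_grid_bound hM (.inl hmM) hG1 hn
    have h5 := mul_le_grid_bound hM (.inr (.inl (Nat.pow_le_pow_left hmM 2))) hG1 (le_refl n)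
    have h6 := mul_le_grid_bound hM (.inr (.inl (Nat.pow_le_pow_left hmM 2))) hG1 hn
    have h7 := mul_le_grid_bound (a := p) hM (.inl (by omega)) hG1 hn
    have h8 := mul_le_grid_bound hM (.inr (.inr le_rfl)) hG1 hn
    have h9 := mul_le_grid_bound hM (.inr (.inr (Nat.pow_le_pow_left hmM 3))) (le_refl G) hn
    have h10 := mul_le_grid_bound hM (.inr (.inl (Nat.pow_le_pow_left hmM 2))) (le_refl G) hn
    have h11 := mul_le_grid_bound hM (.inl hmM) (le_refl G) hn
    have h12 := mul_le_grid_bound (a := 1) hM (.inl hM) (le_refl G) hn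
    have h13 := mul_le_grid_bound (a := p) hM (.inl (by omega)) (le_refl G) hn
    generalize (m + p) ^ 3 * G * n = T at *
    generalize (m + p) ^ 3 = X at *
    -- `54` is the sum of the numerical coefficients of all terms of the step count.
    linarith

theorem costs_pickC (part : Fin m → Fin p) (k : Fin p → ℕ) (hm : 1 ≤ m) (hn : 1 ≤ n) (r : ℕ)
    (t : Fin p → ℕ) (B : Matrix (Fin m) (Fin n) ℝ) :
    CostsAtMost (pickC part (partSize part) k r t B) (fun x => x.length = r)
      (r * (72 * (m * ((m + p) ^ 3 * (∏ l, (partSize part l + 1)) * n)))) := by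
  set G := ∏ l, (partSize part l + 1) with hG
  have hG1 : 1 ≤ G := Finset.one_le_prod' fun l _ => by omega
  induction r generalizing t B with
  | zero =>
    exact (costs_pure (P := fun x : List (Fin m) => x.length = 0) (a := []) rfl).mono
      (fun _ h => h) (Nat.zero_le _)
  | succ r ih =>
    refine (CostsAtMost.tick ((costs_tabulate (P := fun _ _ => True)
      fun i => costs_weightC part k t B i hn).bind fun w _ => (costs_drawC w).bind fun i _ =>
        (costs_dotC (B i) (B i)).bind fun q _ => (costs_projectC B i q).bind fun C _ =>
          (costs_tabulate (K := 0) (P := fun _ _ => True) fun l => costs_pure trivial).bind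
            fun t' _ => (ih t' C).bind fun x hx => costs_pure (by simp [hx]))).mono
              (fun _ h => h) ?_
    have hM : 1 ≤ m + p := by omega
    have h1 := mul_le_grid_bound (a := 1) hM (.inl hM) hG1 hn
    have h2 := mul_le_grid_bound (a := 1) hM (.inl hM) hG1 (le_refl n)
    have h3 := mul_le_grid_bound (a := m) hM (.inl (by omega)) hG1 (le_refl n)
    have h4 := mul_le_grid_bound (a := m) hM (.inl (by omega)) hG1 hn
    have h7 := mul_le_grid_bound (a := p) hM (.inl (by omega)) hG1 hn
    generalize (m + p) ^ 3 * G * n = T at *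
    have h8 : T ≤ m * T := Nat.le_mul_of_pos_left _ hm
    -- A round adds `18` to the `54` of the weights: tick, storing the weights, draw, dot product,
    -- projection and counters contribute `1 + 1 + 2 + 4 + 9 + 1`.
    linarith

theorem costs_sampler (A : Matrix (Fin m) (Fin n) ℝ) (part : Fin m → Fin p) (k : Fin p → ℕ)
    (hm : 1 ≤ m) (hn : 1 ≤ n) (hk : 1 ≤ ∑ l, k l) :
    (sampler A part k).steps ≤
      77 * ((∑ l, k l) * (m * ((m + p) ^ 3 * (∏ l, (partSize part l + 1)) * n))) := by
  refine (CostsAtMost.steps_le (P := fun _ => True) ((CostsAtMost.bind (P := fun x =>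
    x.length = ∑ l, k l) ((costs_tabulate (K := m) (P := fun l c => c = partSize part l)
      fun l => ?_).bind fun sizes hsizes => (costs_loop_pure (List.finRange p)
        (fun c l => c + k l) 0).bind fun total htotal =>
          (costs_tabulate (K := 0) (P := fun _ _ => True) fun l => costs_pure trivial).bind
            (K' := (∑ l, k l) * (72 * (m * ((m + p) ^ 3 * (∏ l, (partSize part l + 1)) * n))))
            fun t _ => ?_) fun x hx => ((costs_loop_pure x (fun S i => insert i S) ∅).mono
              (fun _ _ => trivial) hx.le)))).trans ?_
  · exact (costs_loop_pure (List.finRange m) (fun c i => if part i = l then c + 1 else c) 0).mono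
      (fun c hc => hc.trans (foldl_partSize part l)) (by simp)
  · rw [foldl_total] at htotal
    rw [htotal, show sizes = partSize part from funext hsizes]
    exact costs_pickC part k hm hn _ t A
  · have hG1 : 1 ≤ ∏ l, (partSize part l + 1) := Finset.one_le_prod' fun l _ => by omega
    have hM : 1 ≤ m + p := by omega
    have h1 := mul_le_grid_bound (a := 1) hM (.inl hM) hG1 hn
    have h7 := mul_le_grid_bound (a := p) hM (.inl (by omega)) hG1 hn
    rw [List.length_finRange]
    generalize (m + p) ^ 3 * (∏ l, (partSize part l + 1)) * n = T at *
    generalize ∑ l, k l = K at *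
    have h8 : T ≤ m * T := Nat.le_mul_of_pos_left _ hm
    have h9 : p * m ≤ m * T := by rw [mul_comm]; exact Nat.mul_le_mul_left m (by linarith)
    have h10 : m * T ≤ K * (m * T) := Nat.le_mul_of_pos_left _ hk
    have h11 : K ≤ K * (m * T) := Nat.le_mul_of_pos_right _ (by linarith)
    -- Setup costs `p * m + 3 * p` and the final loop `K`, whence `77 = 72 + 5`.
    linarith

/-- AM-GM for the numbers `m_l + 1`, whose sum is `m + p`. -/
theorem prod_partSize_le (part : Fin m → Fin p) (hp : 1 ≤ p) :
    ((∏ l, (partSize part l + 1) : ℕ) : ℝ) ≤ (1 + (m : ℝ) / p) ^ p := by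
  have hp0 : (p : ℝ) ≠ 0 := by positivity
  have h := Real.geom_mean_le_arith_mean_weighted Finset.univ (fun _ : Fin p => (p : ℝ)⁻¹)
    (fun l => (partSize part l : ℝ) + 1) (fun _ _ => by positivity) (by simp [hp0])
    (fun _ _ => by positivity)
  have hs : ∑ l, (p : ℝ)⁻¹ * ((partSize part l : ℝ) + 1) = 1 + (m : ℝ) / p := by
    rw [← Finset.mul_sum, Finset.sum_add_distrib, ← Nat.cast_sum, sum_partSize]
    simp only [Finset.sum_const, Finset.card_univ, Fintype.card_fin, nsmul_eq_mul, mul_one]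
    field_simp
    ring
  rw [hs] at h
  refine le_trans (le_of_eq ?_) (pow_le_pow_left₀ (Finset.prod_nonneg fun _ _ => by positivity) h p)
  rw [← Finset.prod_pow, Nat.cast_prod]
  refine Finset.prod_congr rfl fun l _ => ?_
  rw [← Real.rpow_natCast, ← Real.rpow_mul (by positivity), inv_mul_cancel₀ hp0, Real.rpow_one]
  push_cast
  rfl

/-- Rules out the degenerate sizes, where the bound could vanish while bookkeeping still costs
steps. For `n = 0` every nonempty set has Gram determinant zero. -/
theorem Feasible.pos {A : Matrix (Fin m) (Fin n) ℝ} {part : Fin m → Fin p} {k : Fin p → ℕ}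
    (h : Feasible A part k) (hk : 1 ≤ ∑ l, k l) : 1 ≤ m ∧ 1 ≤ n ∧ 1 ≤ p := by
  obtain ⟨S, hS, hS'⟩ := h
  have hcard := card_eq_of_partCount_eq (mem_constraintSet.mp hS)
  obtain ⟨i, hi⟩ : S.Nonempty := Finset.card_pos.mp (by omega)
  refine ⟨i.pos, Nat.one_le_iff_ne_zero.mpr ?_, (part i).pos⟩
  rintro rfl
  rw [dpp, PMF.mem_support_normalize_iff, gramDet_eq_zero hi (Subsingleton.elim _ _)] at hS'
  simp at hS'

theorem steps_sampler_le {A : Matrix (Fin m) (Fin n) ℝ} {part : Fin m → Fin p} {k : Fin p → ℕ}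
    (hk : 1 ≤ ∑ l, k l) (h : Feasible A part k) :
    ((sampler A part k).steps : ℝ) ≤ 77 * (((∑ l, k l : ℕ) : ℝ) * (m * (((m : ℝ) + p) ^ 3 *
      (1 + (m : ℝ) / p) ^ p * n))) := by
  obtain ⟨hm, hn, hp⟩ := h.pos hk
  have h1 : ((sampler A part k).steps : ℝ) ≤ _ := Nat.cast_le.mpr (costs_sampler A part k hm hn hk)
  refine h1.trans ?_
  have hG := prod_partSize_le part hp
  generalize ∏ l, (partSize part l + 1) = G at *
  generalize ∑ l, k l = K at *
  push_cast
  gcongr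

end RunningTime

end PartitionDPP

/-! ### Exactness and running time -/

theorem mainTheorem3 :
    -- exactness
    (∀ (m n p : ℕ) (A : Matrix (Fin m) (Fin n) ℝ) (part : Fin m → Fin p) (k : Fin p → ℕ),
      1 ≤ ∑ l, k l → ∀ h : PartitionDPP.Feasible A part k,
        -- the weight computed for the item `i` after the items of `S` have been picked
        (∀ (S : Finset (Fin m)) (i : Fin m),
          (PartitionDPP.weightC part (PartitionDPP.partSize part) k (PartitionDPP.partCount part S)
              (PartitionDPP.residual A S) i).run =
            PMF.pure (some (PartitionDPP.itemWeight A part k S i))) ∧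
        -- the weights are proportional to the conditional marginals of the ordered Partition-DPP
        (∀ t : ℕ, t < ∑ l, k l → ∀ y : Fin t → Fin m, 0 < PartitionDPP.prefixProb A part k y →
          ∀ i : Fin m,
            PartitionDPP.prefixProb A part k (Fin.snoc y i : Fin (t + 1) → Fin m) /
                PartitionDPP.prefixProb A part k y =
              PartitionDPP.itemWeight A part k (Finset.univ.image y) i /
                ((((∑ l, k l : ℕ) : ℝ) - t) *
                  |PartitionDPP.charCoeff
                    (PartitionDPP.residual A (Finset.univ.image y) *
                      (PartitionDPP.residual A (Finset.univ.image y)).transpose) part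
                    (fun l => PartitionDPP.partSize part l - k l +
                      PartitionDPP.partCount part (Finset.univ.image y) l)|)) ∧
        -- the law of the sequence of picked items
        (∀ x : Fin (∑ l, k l) → Fin m,
          (PartitionDPP.orderedSampler A part k).run (some (List.ofFn x)) =
            ENNReal.ofReal (PartitionDPP.orderedProb A part k x)) ∧
        -- the law of the output
        (PartitionDPP.sampler A part k).run = (PartitionDPP.partitionDPP A part k h).map some) ∧
    -- running time, with an absolute constant (`p ≤ m` holds whenever all parts are nonempty)
    (∃ C : ℝ, ∀ (m n p : ℕ) (A : Matrix (Fin m) (Fin n) ℝ) (part : Fin m → Fin p)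
      (k : Fin p → ℕ), 1 ≤ ∑ l, k l → PartitionDPP.Feasible A part k → p ≤ m →
        ((PartitionDPP.sampler A part k).steps : ℝ) ≤
          C * ((m : ℝ) ^ 4 * (1 + (m : ℝ) / p) ^ p * n * ((∑ l, k l : ℕ) : ℝ))) ∧
    -- running time for a constant number of parts
    (∀ p : ℕ, ∃ C : ℝ, ∀ (m n : ℕ) (A : Matrix (Fin m) (Fin n) ℝ) (part : Fin m → Fin p)
      (k : Fin p → ℕ), 1 ≤ ∑ l, k l → PartitionDPP.Feasible A part k →
        ((PartitionDPP.sampler A part k).steps : ℝ) ≤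
          C * ((m : ℝ) ^ (p + 4) * n * ((∑ l, k l : ℕ) : ℝ) / (p : ℝ) ^ p)) := by
  refine ⟨fun m n p A part k hk h => ⟨fun S i => ?_, fun t ht y hy i => ?_, fun x => ?_, ?_⟩,
    ⟨77 * 8, fun m n p A part k hk h hpm => ?_⟩,
    fun p => ⟨77 * ((1 + p) ^ 3 * (1 + p) ^ p), fun m n A part k hk h => ?_⟩⟩
  · exact PartitionDPP.evals_weightC_residual A part k S i
  · exact PartitionDPP.prefixProb_snoc_div ht h.le_partSize y hy i
  · exact PartitionDPP.run_orderedSampler_apply h x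
  · exact PartitionDPP.run_sampler h
  · refine (PartitionDPP.steps_sampler_le hk h).trans ?_
    have hpm' : (p : ℝ) ≤ m := by exact_mod_cast hpm
    -- The factor `8` in the constant is `2 ^ 3`, from `m + p ≤ 2 * m`.
    have hle : ((m : ℝ) + p) ^ 3 ≤ (2 * m) ^ 3 := by gcongr; linarith
    calc _ ≤ 77 * (((∑ l, k l : ℕ) : ℝ) * (m * ((2 * (m : ℝ)) ^ 3 *
          (1 + (m : ℝ) / p) ^ p * n))) := by gcongr
      _ = _ := by ring
  · refine (PartitionDPP.steps_sampler_le hk h).trans ?_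
    obtain ⟨hm, -, hp⟩ := h.pos hk
    have hm' : (1 : ℝ) ≤ m := by exact_mod_cast hm
    have hp' : (1 : ℝ) ≤ p := by exact_mod_cast hp
    -- Empty parts are allowed here, so `p ≤ m` may fail; `m + p ≤ (1 + p) * m` replaces it, both in
    -- the cubic factor and in the grid size.
    have hle : (m : ℝ) + p ≤ (1 + p) * m := by nlinarith
    have hgrid : 1 + (m : ℝ) / p ≤ (1 + p) * m / p := by
      rw [le_div_iff₀ (by positivity)]
      field_simp
      linarith
    calc _ ≤ 77 * (((∑ l, k l : ℕ) : ℝ) * (m * (((1 + p) * (m : ℝ)) ^ 3 *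
          ((1 + p) * (m : ℝ) / p) ^ p * n))) := by gcongr
      _ = _ := by
        rw [div_pow, mul_pow, mul_pow]
        ring
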